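/- **Conventions.** A signature $\Sigma$ is a set of function symbols and a set of predicate symbols, each with an arity in $\mathbb{N}$, besides equality, which is always available; signatures are countable, their symbols being numbered by natural numbers so that formulas can be given to algorithms. A $\Sigma$-theory $\mathcal{T}$ is given by a (finite or infinite) set $\mathrm{Ax}(\mathcal{T})$ of $\Sigma$-sentences. A $\mathcal{T}$-interpretation is a $\Sigma$-structure with non-empty domain in which all sentences of $\mathrm{Ax}(\mathcal{T})$ hold, together with an assignment of elements of the domain to the variables; a formula is $\mathcal{T}$-satisfiable if some $\mathcal{T}$-interpretation satisfies it. $\mathcal{T}$ is *decidable* if it is decidable whether a given quantifier-free $\Sigma$-formula is $\mathcal{T}$-satisfiable. For a quantifier-free formula $\varphi$, the *spectrum* $\mathrm{Spec}(\mathcal{T},\varphi)$ is the set of countable (finite or $\aleph_0$) cardinalities of the domains of $\mathcal{T}$-interpretations that satisfy $\varphi$. Write $\mathbb{N}^*=\{1,2,3,\dots\}$. * $\mathcal{T}$ is *gentle* if there is an algorithm that, for every conjunction $\varphi$ of literals, outputs a pair $(b,S)$ of a boolean $b$ and a finite set $S\subset\mathbb{N}^*$ such that $\mathrm{Spec}(\mathcal{T},\varphi)=S$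 if $b$ is true and $\mathrm{Spec}(\mathcal{T},\varphi)=(\mathbb{N}^*\cup\{\aleph_0\})\setminus S$ if $b$ is false. * $\mathcal{T}$ has *computable finite spectra* if there is an algorithm that, given a quantifier-free formula $\varphi$ and $k\in\mathbb{N}^*$, decides whether $k\in\mathrm{Spec}(\mathcal{T},\varphi)$. If $\Sigma_1$ and $\Sigma_2$ are disjoint (they share only equality), and $\mathcal{T}_1$, $\mathcal{T}_2$ are a $\Sigma_1$-theory and a $\Sigma_2$-theory, then $\mathcal{T}_1\oplus\mathcal{T}_2$ is the $(\Sigma_1\cup\Sigma_2)$-theory axiomatized by $\mathrm{Ax}(\mathcal{T}_1)\cup\mathrm{Ax}(\mathcal{T}_2)$. **Theorem.** Let $\mathcal{T}_1$ and $\mathcal{T}_2$ be theories over disjoint signatures $\Sigma_1$ and $\Sigma_2$. 1. If $\mathcal{T}_1$ is gentle, and $\mathcal{T}_2$ is decidable and has computable finite spectra, then $\mathcal{T}_1\oplus\mathcal{T}_2$ is decidable. 2. This strengthens Fontaine's gentle combination theorem: $\mathcal{T}_2$ has computable finite spectra as soon as it satisfies any one of the three conditions of that theorem, namely (i) $\mathcal{T}_2$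 is gentle; (ii) $\mathcal{T}_2$ is finitely axiomatizable (some finite set of sentences has the same models as $\mathrm{Ax}(\mathcal{T}_2)$); (iii) there is an algorithm that, for every conjunction $\varphi$ of $\Sigma_2$-literals, outputs a finite set $S\subset\mathbb{N}\cup\{\aleph_0\}$ with $\mathrm{Spec}(\mathcal{T}_2,\varphi)=S$. -/

import Mathlib

namespace TheoryCombination

open FirstOrder FirstOrder.Language
open scoped Cardinal

/-! ### Syntax: literals, conjunctions of literals, Gödel codes -/

/-- A literal: an atomic formula (an equation or a predicate applied to terms) or its negation. -/
def IsLiteral {L : FirstOrder.Language.{0, 0}} (φ : L.Formula ℕ) : Prop :=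
  BoundedFormula.IsAtomic φ ∨ ∃ ψ : L.Formula ℕ, BoundedFormula.IsAtomic ψ ∧ φ = Formula.not ψ

/-- A cube: a conjunction of literals. -/
inductive IsCube {L : FirstOrder.Language.{0, 0}} : L.Formula ℕ → Prop
  | literal {φ : L.Formula ℕ} : IsLiteral φ → IsCube φ
  | conj {φ ψ : L.Formula ℕ} : IsCube φ → IsCube ψ → IsCube (φ ⊓ ψ)

/-- The Gödel code of a term, the symbols of the signature being numbered by `Encodable.encode`.
The free variables are `Sum.inl i`, the variables reserved for quantifiers are `Sum.inr i`.
The list of the codes of the arguments (hence the arity) can be read off from the code. -/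
def termCode {L : FirstOrder.Language.{0, 0}} [Encodable (Σ n, L.Functions n)] {m : ℕ} :
    L.Term (ℕ ⊕ Fin m) → ℕ
  | .var (Sum.inl i) => Nat.pair 0 i
  | .var (Sum.inr i) => Nat.pair 1 i
  | .func (l := l) f ts =>
      Nat.pair 2 (Nat.pair (Encodable.encode (⟨l, f⟩ : Σ n, L.Functions n))
        (Encodable.encode (List.ofFn fun i => termCode (ts i))))

/-- The Gödel code of a first-order formula. -/
def code {L : FirstOrder.Language.{0, 0}} [Encodable (Σ n, L.Functions n)] [Encodable (Σ n, L.Relations n)] :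
    {m : ℕ} → L.BoundedFormula ℕ m → ℕ
  | _, .falsum => Nat.pair 0 0
  | _, .equal s t => Nat.pair 1 (Nat.pair (termCode s) (termCode t))
  | _, .rel (l := l) R ts =>
      Nat.pair 2 (Nat.pair (Encodable.encode (⟨l, R⟩ : Σ n, L.Relations n))
        (Encodable.encode (List.ofFn fun i => termCode (ts i))))
  | _, .imp φ ψ => Nat.pair 3 (Nat.pair (code φ) (code ψ))
  | _, .all φ => Nat.pair 4 (code φ)

/-! ### Semantics: satisfiability and spectra -/

/-- `φ` is `T`-satisfiable: some `T`-interpretation, that is, a model of the axioms `T` together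
with an assignment of values to the variables, satisfies `φ`. (The signatures are countable, so
by Löwenheim–Skolem it does not matter in which universe the domains are taken. The domain is
non-empty, since the variables have values in it.) -/
def Satisfiable {L : FirstOrder.Language.{0, 0}} (T : L.Theory) (φ : L.Formula ℕ) : Prop :=
  ∃ (M : Type) (_ : L.Structure M) (v : ℕ → M), M ⊨ T ∧ φ.Realize v

/-- `Spec(T, φ)`: the countable (finite or `ℵ₀`) cardinalities of the `T`-interpretations that
satisfy `φ`. -/
def Spec {L : FirstOrder.Language.{0, 0}} (T : L.Theory) (φ : L.Formula ℕ) : Set Cardinal.{0} :=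
  {κ | κ ≤ ℵ₀ ∧
    ∃ (M : Type) (_ : L.Structure M) (v : ℕ → M), M ⊨ T ∧ φ.Realize v ∧ #M = κ}

/-! ### Computability properties of theories -/

section
variable {L : FirstOrder.Language.{0, 0}} [Encodable (Σ n, L.Functions n)] [Encodable (Σ n, L.Relations n)]

/-- `T` is decidable: an algorithm decides, given a quantifier-free formula `φ`, whether `φ` is
`T`-satisfiable. -/
def IsDecidable (T : L.Theory) : Prop :=
  ∃ f : ℕ → Bool, Computable f ∧
    ∀ φ : L.Formula ℕ, BoundedFormula.IsQF φ → (f (code φ) = true ↔ Satisfiable T φ)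

/-- `T` is gentle: an algorithm outputs, given a conjunction `φ` of literals, a pair of a boolean
`b` and (a list of the elements of) a finite set `S` of positive integers, such that `Spec(T, φ)`
is `S` if `b` is true, and is the complement of `S` in `{1, 2, 3, …} ∪ {ℵ₀}` if `b` is false. -/
def IsGentle (T : L.Theory) : Prop :=
  ∃ f : ℕ → Bool × List ℕ, Computable f ∧
    ∀ φ : L.Formula ℕ, IsCube φ →
      (∀ n ∈ (f (code φ)).2, 0 < n) ∧
      ((f (code φ)).1 = true → Spec T φ = {κ | ∃ n ∈ (f (code φ)).2, κ = (n : Cardinal)}) ∧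
      ((f (code φ)).1 = false → Spec T φ =
        {κ | 0 < κ ∧ κ ≤ ℵ₀ ∧ ¬ ∃ n ∈ (f (code φ)).2, κ = (n : Cardinal)})

/-- `T` has computable finite spectra: an algorithm decides, given a quantifier-free formula `φ`
and a positive integer `k`, whether `k ∈ Spec(T, φ)`. -/
def HasComputableFiniteSpectra (T : L.Theory) : Prop :=
  ∃ f : ℕ → ℕ → Bool, Computable₂ f ∧
    ∀ φ : L.Formula ℕ, BoundedFormula.IsQF φ → ∀ k : ℕ, 0 < k →
      (f (code φ) k = true ↔ (k : Cardinal) ∈ Spec T φ)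

/-- An algorithm outputs, given a conjunction `φ` of literals, (a list of the elements of) a finite
set `S` of natural numbers and possibly `ℵ₀`, the latter represented by `none`, such that
`Spec(T, φ) = S`. -/
def HasComputableSpectraAsFiniteSets (T : L.Theory) : Prop :=
  ∃ f : ℕ → List (Option ℕ), Computable f ∧
    ∀ φ : L.Formula ℕ, IsCube φ →
      Spec T φ = {κ | (∃ n : ℕ, some n ∈ f (code φ) ∧ κ = (n : Cardinal)) ∨
        (none ∈ f (code φ) ∧ κ = ℵ₀)}

end

/-- `T` is finitely axiomatizable: some finite set of sentences has the same models. -/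
def IsFinitelyAxiomatizable {L : FirstOrder.Language.{0, 0}} (T : L.Theory) : Prop :=
  ∃ A : L.Theory, A.Finite ∧
    ∀ (M : Type) [L.Structure M] [Nonempty M], M ⊨ T ↔ M ⊨ A

/-! ### Combination of theories over disjoint signatures -/

/-- The function symbols of the disjoint union of two signatures are numbered by `2 * c` for the
symbol number `c` of the first and by `2 * c + 1` for the symbol number `c` of the second. -/
instance encodableSumFunctions (L₁ L₂ : FirstOrder.Language.{0, 0})
    [Encodable (Σ n, L₁.Functions n)] [Encodable (Σ n, L₂.Functions n)] :
    Encodable (Σ n, (L₁.sum L₂).Functions n) :=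
  Encodable.ofEquiv ((Σ n, L₁.Functions n) ⊕ (Σ n, L₂.Functions n))
    (Equiv.sigmaSumDistrib L₁.Functions L₂.Functions)

/-- The predicate symbols of the disjoint union of two signatures are numbered likewise. -/
instance encodableSumRelations (L₁ L₂ : FirstOrder.Language.{0, 0})
    [Encodable (Σ n, L₁.Relations n)] [Encodable (Σ n, L₂.Relations n)] :
    Encodable (Σ n, (L₁.sum L₂).Relations n) :=
  Encodable.ofEquiv ((Σ n, L₁.Relations n) ⊕ (Σ n, L₂.Relations n))
    (Equiv.sigmaSumDistrib L₁.Relations L₂.Relations)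

/-- `T₁ ⊕ T₂`: the theory over the union of the two disjoint signatures whose axioms are those of
`T₁` together with those of `T₂`. -/
def combine {L₁ L₂ : FirstOrder.Language.{0, 0}} (T₁ : L₁.Theory) (T₂ : L₂.Theory) : (L₁.sum L₂).Theory :=
  (LHom.sumInl : L₁ →ᴸ L₁.sum L₂).onTheory T₁ ∪ (LHom.sumInr : L₂ →ᴸ L₁.sum L₂).onTheory T₂

end TheoryCombination

/-!
Guess which subformulas of a quantifier-free formula `φ` over the union of the signatures are true,
and which of its subterms are equal. With one variable for the value of each subterm, a guess that
is consistent with the connectives and makes `φ` true amounts to two conjunctions of literals, one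
over each signature, which share only the equalities and inequalities between those variables. As
the latter are decided by the guess, two models of equal cardinality can be merged along a bijection
that matches the values of the variables. So `φ` is satisfiable modulo `T₁ ⊕ T₂` if and only if for
some guess the spectra of the two conjunctions meet, where by the downward Löwenheim–Skolem theorem
countable cardinalities suffice.

If `T₁` is gentle, there is a computable `j` such that its spectrum contains every countable
cardinality from `j` on, or none of them. So it remains to compare finitely many finite
cardinalities, and possibly to ask `T₂` for a model with at least `j` elements: this is the
satisfiability of the second conjunction together with `x_a ≠ x_b` for `b < a < j`.

If `T₂` has the same models as a single sentence `ψ`, only the finitely many symbols that occur in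
`ψ` or in the guess matter, so the structures of a given finite cardinality can be searched.
-/

namespace TheoryCombination

open FirstOrder FirstOrder.Language
open scoped Cardinal

/-! ### Codes and their constituents -/

section Injectivity
variable {L : FirstOrder.Language.{0, 0}} [Encodable (Σ n, L.Functions n)]

theorem termCode_injective {m : ℕ} :
    Function.Injective (termCode : L.Term (ℕ ⊕ Fin m) → ℕ) := by
  intro s
  induction s with
  | var x =>
    intro t h
    rcases t with (y | _)
    · rcases x with x | x <;> rcases y with y | y <;>
        simp_all [termCode, Nat.pair_eq_pair, Fin.ext_iff]
    · rcases x with x | x <;> simp [termCode, Nat.pair_eq_pair] at h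
  | func f ts ih =>
    intro t h
    rcases t with (y | @⟨k, g, us⟩)
    · rcases y with y | y <;> simp [termCode, Nat.pair_eq_pair] at h
    · simp only [termCode, Nat.pair_eq_pair, Encodable.encode_inj, true_and] at h
      obtain ⟨hsymbol, hargs⟩ := h
      cases hsymbol
      congr 1
      funext i
      exact ih i (congrFun (List.ofFn_injective hargs) i)

variable [Encodable (Σ n, L.Relations n)]

theorem code_injective {m : ℕ} :
    Function.Injective (code : L.BoundedFormula ℕ m → ℕ) := by
  intro φ
  induction φ with
  | falsum => intro ψ h; cases ψ <;> simp_all [code, Nat.pair_eq_pair]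
  | equal s t =>
    intro ψ h
    cases ψ <;> simp_all [code, Nat.pair_eq_pair, termCode_injective.eq_iff]
  | rel R ts =>
    intro ψ h
    cases ψ with
    | rel S us =>
      simp only [code, Nat.pair_eq_pair, Encodable.encode_inj, true_and] at h
      obtain ⟨hsymbol, hargs⟩ := h
      cases hsymbol
      congr 1
      funext i
      exact termCode_injective (congrFun (List.ofFn_injective hargs) i)
    | _ => simp [code, Nat.pair_eq_pair] at h
  | imp φ₁ φ₂ ih₁ ih₂ =>
    intro ψ h
    cases ψ with
    | imp ψ₁ ψ₂ =>
      simp only [code, Nat.pair_eq_pair, true_and] at h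
      rw [ih₁ h.1, ih₂ h.2]
    | _ => simp [code, Nat.pair_eq_pair] at h
  | all φ ih =>
    intro ψ h
    cases ψ with
    | all ψ =>
      simp only [code, Nat.pair_eq_pair, true_and] at h
      rw [ih h]
    | _ => simp [code, Nat.pair_eq_pair] at h

end Injectivity

/-- The constructor recorded in a code. -/
def tag (m : ℕ) : ℕ := m.unpair.1

/-- The first component of the data recorded in a code: the number of the symbol of an
application, the left-hand side of an equation or of an implication. -/
def lhs (m : ℕ) : ℕ := m.unpair.2.unpair.1

/-- The second component of the data recorded in a code. -/
def rhs (m : ℕ) : ℕ := m.unpair.2.unpair.2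

/-- The list of argument codes recorded in the code of an application of a symbol. -/
def args (m : ℕ) : List ℕ := Denumerable.ofNat (List ℕ) (rhs m)

@[simp] theorem tag_pair (a b : ℕ) : tag (Nat.pair a b) = a := by simp [tag]

@[simp] theorem lhs_pair_pair (a b c : ℕ) : lhs (Nat.pair a (Nat.pair b c)) = b := by simp [lhs]

@[simp] theorem rhs_pair_pair (a b c : ℕ) : rhs (Nat.pair a (Nat.pair b c)) = c := by simp [rhs]

@[simp] theorem args_pair_pair (a b : ℕ) (l : List ℕ) :
    args (Nat.pair a (Nat.pair b (Encodable.encode l))) = l := by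
  simp [args]

theorem unpair_snd_lt {m : ℕ} (h : tag m ≠ 0) : m.unpair.2 < m := by
  have hadd := Nat.unpair_add_le m
  have hpos : 0 < m.unpair.1 := Nat.pos_of_ne_zero h
  omega

theorem lhs_lt {m : ℕ} (h : tag m ≠ 0) : lhs m < m :=
  (Nat.unpair_left_le _).trans_lt (unpair_snd_lt h)

theorem rhs_lt {m : ℕ} (h : tag m ≠ 0) : rhs m < m :=
  (Nat.unpair_right_le _).trans_lt (unpair_snd_lt h)

theorem encode_lt_encode_of_mem {α : Type*} [Encodable α] {a : α} {l : List α} (h : a ∈ l) :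
    Encodable.encode a < Encodable.encode l := by
  induction l with
  | nil => cases h
  | cons b l ih =>
    rw [Encodable.encode_list_cons, Nat.lt_succ_iff]
    rcases List.mem_cons.1 h with rfl | h
    · exact Nat.left_le_pair _ _
    · exact (ih h).le.trans (Nat.right_le_pair _ _)

theorem lt_of_mem_args {a m : ℕ} (h : a ∈ args m) : a < m := by
  have hlt : a < Encodable.encode (args m) := encode_lt_encode_of_mem h
  rw [args, Denumerable.encode_ofNat] at hlt
  exact hlt.trans_le ((Nat.unpair_right_le _).trans (Nat.unpair_right_le _))

section Descendants
variable {α : Type*} (step : α → List α)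

/-- The elements reached from `a` by at most `n` steps, where a step leads from `x` to any element
of the list `step x`. -/
def descendants (n : ℕ) (a : α) : List α := (fun l => l ++ l.flatMap step)^[n] [a]

variable {step}

theorem mem_descendants_zero {a x : α} : x ∈ descendants step 0 a ↔ x = a :=
  List.mem_singleton

theorem mem_descendants_succ {n : ℕ} {a x : α} :
    x ∈ descendants step (n + 1) a ↔
      x ∈ descendants step n a ∨ ∃ y ∈ descendants step n a, x ∈ step y := by
  rw [descendants, Function.iterate_succ_apply', ← descendants, List.mem_append, List.mem_flatMap]

theorem self_mem_descendants (n : ℕ) (a : α) : a ∈ descendants step n a := by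
  induction n with
  | zero => exact mem_descendants_zero.2 rfl
  | succ n ih => exact mem_descendants_succ.2 (Or.inl ih)

theorem descendants_induction {p : α → Prop} {a : α} (base : p a)
    (closed : ∀ x, p x → ∀ y ∈ step x, p y) (n : ℕ) : ∀ x ∈ descendants step n a, p x := by
  induction n with
  | zero => intro x hx; rwa [mem_descendants_zero.1 hx]
  | succ n ih =>
    intro x hx
    rcases mem_descendants_succ.1 hx with hx | ⟨y, hy, hxy⟩
    exacts [ih x hx, closed y (ih y hy) x hxy]

theorem descendants_closed_or_add_le {μ : α → ℕ} (hμ : ∀ x, ∀ y ∈ step x, μ y < μ x)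
    (n : ℕ) (a : α) : ∀ x ∈ descendants step n a,
      (∀ y ∈ step x, y ∈ descendants step n a) ∨ μ x + n ≤ μ a := by
  induction n with
  | zero => intro x hx; rw [mem_descendants_zero.1 hx]; exact Or.inr le_rfl
  | succ n ih =>
    intro x hx
    by_cases hold : x ∈ descendants step n a
    · exact Or.inl fun y hy => mem_descendants_succ.2 (Or.inr ⟨x, hold, hy⟩)
    obtain ⟨z, hz, hxz⟩ := (mem_descendants_succ.1 hx).resolve_left hold
    rcases ih z hz with hclosed | hle
    · exact absurd (hclosed x hxz) hold
    · have := hμ z x hxz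
      exact Or.inr (by omega)

theorem descendants_closed {μ : α → ℕ} (hμ : ∀ x, ∀ y ∈ step x, μ y < μ x) {n : ℕ} {a x y : α}
    (hn : μ a < n) (hx : x ∈ descendants step n a) (hy : y ∈ step x) :
    y ∈ descendants step n a := by
  rcases descendants_closed_or_add_le hμ n a x hx with h | h
  exacts [h y hy, by omega]

end Descendants

/-- The immediate constituents of a term (marked `false`) or formula (marked `true`), on codes. -/
def constituents (x : Bool × ℕ) : List (Bool × ℕ) :=
  if tag x.2 = 2 then (args x.2).map (Prod.mk false)
  else if x.1 = true ∧ tag x.2 = 1 then [(false, lhs x.2), (false, rhs x.2)]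
  else if x.1 = true ∧ tag x.2 = 3 then [(true, lhs x.2), (true, rhs x.2)]
  else []

theorem snd_lt_of_mem_constituents (x y : Bool × ℕ) (h : y ∈ constituents x) : y.2 < x.2 := by
  unfold constituents at h
  split_ifs at h with happ heq himp
  · obtain ⟨a, ha, rfl⟩ := List.mem_map.1 h
    exact lt_of_mem_args ha
  · have htag : tag x.2 ≠ 0 := by omega
    rcases List.mem_pair.1 h with rfl | rfl
    exacts [lhs_lt htag, rhs_lt htag]
  · have htag : tag x.2 ≠ 0 := by omega
    rcases List.mem_pair.1 h with rfl | rfl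
    exacts [lhs_lt htag, rhs_lt htag]
  · cases h

/-- The subformulas and subterms of the formula with code `n`. -/
def nodes (n : ℕ) : List (Bool × ℕ) := descendants constituents (n + 1) (true, n)

theorem nodes_closed {n : ℕ} {x y : Bool × ℕ} (hx : x ∈ nodes n) (hy : y ∈ constituents x) :
    y ∈ nodes n :=
  descendants_closed snd_lt_of_mem_constituents (Nat.lt_succ_self n) hx hy

/-- The codes of the subterms of the formula with code `n`. -/
def termNodes (n : ℕ) : List ℕ := ((nodes n).filter fun x => x.1 = false).map Prod.snd

/-- The codes of the subformulas of the formula with code `n`. -/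
def formulaNodes (n : ℕ) : List ℕ := ((nodes n).filter fun x => x.1 = true).map Prod.snd

theorem mem_termNodes {n m : ℕ} : m ∈ termNodes n ↔ (false, m) ∈ nodes n := by
  simp [termNodes]

theorem mem_formulaNodes {n m : ℕ} : m ∈ formulaNodes n ↔ (true, m) ∈ nodes n := by
  simp [formulaNodes]

theorem self_mem_formulaNodes (n : ℕ) : n ∈ formulaNodes n :=
  mem_formulaNodes.2 (self_mem_descendants _ _)

section Genuine
variable {L : FirstOrder.Language.{0, 0}} [Encodable (Σ n, L.Functions n)] {m : ℕ}

theorem mem_termNodes_of_func {n k : ℕ} {f : L.Functions k} {ts : Fin k → L.Term (ℕ ⊕ Fin m)}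
    (h : termCode (Term.func f ts) ∈ termNodes n) (i : Fin k) : termCode (ts i) ∈ termNodes n := by
  rw [mem_termNodes] at h ⊢
  exact nodes_closed h (by simp [constituents, termCode])

theorem exists_term_of_mem_constituents {t : L.Term (ℕ ⊕ Fin m)} {y : Bool × ℕ}
    (hy : y ∈ constituents (false, termCode t)) :
    ∃ s : L.Term (ℕ ⊕ Fin m), y = (false, termCode s) := by
  cases t with
  | var x => rcases x with x | x <;> simp [constituents, termCode] at hy
  | func f ts =>
    simp only [constituents, termCode, tag_pair, if_true, args_pair_pair, List.mem_map,
      List.mem_ofFn] at hy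
    obtain ⟨_, ⟨i, rfl⟩, rfl⟩ := hy
    exact ⟨ts i, rfl⟩

variable [Encodable (Σ n, L.Relations n)]

theorem mem_termNodes_of_rel {n k : ℕ} {R : L.Relations k} {ts : Fin k → L.Term (ℕ ⊕ Fin m)}
    (h : code (BoundedFormula.rel R ts) ∈ formulaNodes n) (i : Fin k) :
    termCode (ts i) ∈ termNodes n :=
  mem_termNodes.2 (nodes_closed (mem_formulaNodes.1 h) (by simp [constituents, code]))

theorem mem_termNodes_of_equal {n : ℕ} {s t : L.Term (ℕ ⊕ Fin m)}
    (h : code (BoundedFormula.equal s t) ∈ formulaNodes n) :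
    termCode s ∈ termNodes n ∧ termCode t ∈ termNodes n := by
  rw [mem_termNodes, mem_termNodes]
  constructor <;> exact nodes_closed (mem_formulaNodes.1 h) (by simp [constituents, code])

theorem mem_formulaNodes_of_imp {n : ℕ} {φ ψ : L.BoundedFormula ℕ m}
    (h : code (BoundedFormula.imp φ ψ) ∈ formulaNodes n) :
    code φ ∈ formulaNodes n ∧ code ψ ∈ formulaNodes n := by
  rw [mem_formulaNodes] at h
  rw [mem_formulaNodes, mem_formulaNodes]
  constructor <;> exact nodes_closed h (by simp [constituents, code])

theorem exists_term_or_formula_of_mem_constituents {ψ : L.BoundedFormula ℕ m} (hψ : ψ.IsQF)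
    {y : Bool × ℕ} (hy : y ∈ constituents (true, code ψ)) :
    (∃ s : L.Term (ℕ ⊕ Fin m), y = (false, termCode s)) ∨
      ∃ χ : L.BoundedFormula ℕ m, χ.IsQF ∧ y = (true, code χ) := by
  cases hψ with
  | falsum => simp [constituents, code] at hy
  | of_isAtomic h =>
    left
    cases h with
    | equal s t =>
      rcases (by simpa [constituents, Term.bdEqual, code] using hy : y = _ ∨ y = _) with rfl | rfl
      exacts [⟨s, rfl⟩, ⟨t, rfl⟩]
    | rel R ts =>
      simp only [constituents, Relations.boundedFormula, code, tag_pair, if_true, args_pair_pair,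
        List.mem_map, List.mem_ofFn] at hy
      obtain ⟨_, ⟨i, rfl⟩, rfl⟩ := hy
      exact ⟨ts i, rfl⟩
  | @imp φ₁ φ₂ h₁ h₂ =>
    right
    rcases (by simpa [constituents, code] using hy : y = _ ∨ y = _) with rfl | rfl
    exacts [⟨φ₁, h₁, rfl⟩, ⟨φ₂, h₂, rfl⟩]

theorem exists_term_or_formula_of_mem_nodes {φ : L.BoundedFormula ℕ m} (hφ : φ.IsQF) :
    ∀ x ∈ nodes (code φ), (∃ t : L.Term (ℕ ⊕ Fin m), x = (false, termCode t)) ∨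
      ∃ ψ : L.BoundedFormula ℕ m, ψ.IsQF ∧ x = (true, code ψ) := by
  refine descendants_induction ?_ ?_ _
  · exact Or.inr ⟨φ, hφ, rfl⟩
  rintro _ (⟨t, rfl⟩ | ⟨ψ, hψ, rfl⟩) y hy
  · exact Or.inl (exists_term_of_mem_constituents hy)
  · exact exists_term_or_formula_of_mem_constituents hψ hy

theorem exists_term_of_mem_termNodes {φ : L.BoundedFormula ℕ m} (hφ : φ.IsQF) {c : ℕ}
    (h : c ∈ termNodes (code φ)) : ∃ t : L.Term (ℕ ⊕ Fin m), termCode t = c := by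
  simpa [eq_comm] using exists_term_or_formula_of_mem_nodes hφ _ (mem_termNodes.1 h)

theorem exists_formula_of_mem_formulaNodes {φ : L.BoundedFormula ℕ m} (hφ : φ.IsQF) {c : ℕ}
    (h : c ∈ formulaNodes (code φ)) : ∃ ψ : L.BoundedFormula ℕ m, ψ.IsQF ∧ code ψ = c := by
  simpa [eq_comm] using exists_term_or_formula_of_mem_nodes hφ _ (mem_formulaNodes.1 h)

theorem exists_func_of_mem_termNodes {φ : L.BoundedFormula ℕ m} (hφ : φ.IsQF) {c : ℕ}
    (h : c ∈ termNodes (code φ)) (htag : tag c = 2) :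
    ∃ (k : ℕ) (f : L.Functions k) (ts : Fin k → L.Term (ℕ ⊕ Fin m)),
      termCode (Term.func f ts) = c := by
  obtain ⟨t, rfl⟩ := exists_term_of_mem_termNodes hφ h
  cases t with
  | var x => rcases x with x | x <;> simp [termCode] at htag
  | func f ts => exact ⟨_, f, ts, rfl⟩

theorem exists_rel_of_mem_formulaNodes {φ : L.BoundedFormula ℕ m} (hφ : φ.IsQF) {c : ℕ}
    (h : c ∈ formulaNodes (code φ)) (htag : tag c = 2) :
    ∃ (k : ℕ) (R : L.Relations k) (ts : Fin k → L.Term (ℕ ⊕ Fin m)),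
      code (BoundedFormula.rel R ts) = c := by
  obtain ⟨ψ, hψ, rfl⟩ := exists_formula_of_mem_formulaNodes hφ h
  cases hψ with
  | falsum => simp [code] at htag
  | imp => simp [code] at htag
  | of_isAtomic h =>
    cases h with
    | equal => simp [code, Term.bdEqual] at htag
    | rel R ts => exact ⟨_, R, ts, rfl⟩

end Genuine

/-! ### Guesses and diagrams -/

/-- The code of the equation between the terms with the given codes. -/
def equalCode (s t : ℕ) : ℕ := Nat.pair 1 (Nat.pair s t)

/-- The codes of the subformulas, and of the equations between subterms, of the formula with
code `n`: the formulas whose truth values are guessed. -/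
def candidates (n : ℕ) : List ℕ :=
  formulaNodes n ++ (termNodes n).flatMap fun s => (termNodes n).map (equalCode s)

/-- All sets of candidates, a guess being the set of the candidates supposed to be true. -/
def guesses (n : ℕ) : List (List ℕ) := (candidates n).sublists'

/-- The guess `A` respects the propositional connectives and contains the formula with code `n`. -/
def IsTruthSet (n : ℕ) (A : List ℕ) : Prop :=
  n ∈ A ∧ ∀ m ∈ formulaNodes n, (tag m = 0 → m ∉ A) ∧
    (tag m = 3 → (m ∈ A ↔ (lhs m ∈ A → rhs m ∈ A)))

/-- The facts about the `L'`-symbols that the guess `A` asserts for the formula with code `n`,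
where `w m` stands for the value of the subterm with code `m`. -/
structure Diagram {L L' : FirstOrder.Language.{0, 0}} [Encodable (Σ n, L.Functions n)]
    [Encodable (Σ n, L.Relations n)] (ι : L' →ᴸ L) (n : ℕ) (A : List ℕ) (M : Type*)
    [L'.Structure M] (w : ℕ → M) : Prop where
  equal : ∀ s ∈ termNodes n, ∀ t ∈ termNodes n, (w s = w t ↔ equalCode s t ∈ A)
  func : ∀ (k : ℕ) (f : L'.Functions k) (ts : Fin k → L.Term (ℕ ⊕ Fin 0)),
    termCode (Term.func (ι.onFunction f) ts) ∈ termNodes n →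
      w (termCode (Term.func (ι.onFunction f) ts)) =
        Structure.funMap f fun i => w (termCode (ts i))
  rel : ∀ (k : ℕ) (R : L'.Relations k) (ts : Fin k → L.Term (ℕ ⊕ Fin 0)),
    code (BoundedFormula.rel (ι.onRelation R) ts : L.Formula ℕ) ∈ formulaNodes n →
      ((Structure.RelMap R fun i => w (termCode (ts i))) ↔
        code (BoundedFormula.rel (ι.onRelation R) ts : L.Formula ℕ) ∈ A)

section Guesses
variable {L : FirstOrder.Language.{0, 0}} [Encodable (Σ n, L.Functions n)]
  {M : Type*} [L.Structure M]

variable (L) in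
/-- The value, under the assignment `v`, of the `L`-term with code `c` (and `v 0` if there is
none). -/
noncomputable def valueOfCode (v : ℕ → M) (c : ℕ) : M :=
  Function.extend (termCode : L.Term (ℕ ⊕ Fin 0) → ℕ) (Term.realize (Sum.elim v default))
    (fun _ => v 0) c

theorem valueOfCode_termCode (v : ℕ → M) (t : L.Term (ℕ ⊕ Fin 0)) :
    valueOfCode L v (termCode t) = t.realize (Sum.elim v default) :=
  termCode_injective.extend_apply _ _ t

variable [Encodable (Σ n, L.Relations n)]

variable (L) in
/-- The number `c` is the code of an `L`-formula that holds under the assignment `v`. -/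
def HoldsCode (v : ℕ → M) (c : ℕ) : Prop :=
  ∃ ψ : L.Formula ℕ, code ψ = c ∧ ψ.Realize v

theorem holdsCode_code {v : ℕ → M} (ψ : L.Formula ℕ) : HoldsCode L v (code ψ) ↔ ψ.Realize v :=
  ⟨fun ⟨_, hcode, hψ⟩ => code_injective hcode ▸ hψ, fun h => ⟨ψ, rfl, h⟩⟩

variable (L) in
open Classical in
/-- The guess that is correct under the assignment `v`. -/
noncomputable def trueCandidates (v : ℕ → M) (n : ℕ) : List ℕ :=
  (candidates n).filter (HoldsCode L v)

theorem mem_trueCandidates {v : ℕ → M} {n c : ℕ} :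
    c ∈ trueCandidates L v n ↔ c ∈ candidates n ∧ HoldsCode L v c := by
  simp [trueCandidates]

theorem trueCandidates_mem_guesses (v : ℕ → M) (n : ℕ) : trueCandidates L v n ∈ guesses n :=
  List.mem_sublists'.2 List.filter_sublist

theorem code_mem_trueCandidates {v : ℕ → M} {n : ℕ} {ψ : L.Formula ℕ}
    (hψ : code ψ ∈ formulaNodes n) : code ψ ∈ trueCandidates L v n ↔ ψ.Realize v := by
  rw [mem_trueCandidates, holdsCode_code, and_iff_right]
  exact List.mem_append_left _ hψ

theorem isTruthSet_trueCandidates {φ : L.Formula ℕ} (hφ : φ.IsQF) {v : ℕ → M}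
    (h : φ.Realize v) : IsTruthSet (code φ) (trueCandidates L v (code φ)) := by
  refine ⟨(code_mem_trueCandidates (self_mem_formulaNodes _)).2 h, fun m hm => ?_⟩
  obtain ⟨ψ, hψ, rfl⟩ := exists_formula_of_mem_formulaNodes hφ hm
  rw [code_mem_trueCandidates hm]
  cases hψ with
  | falsum => simp [code, Formula.Realize, BoundedFormula.Realize]
  | of_isAtomic h => cases h <;> simp [code, Term.bdEqual, Relations.boundedFormula]
  | @imp φ₁ φ₂ h₁ h₂ =>
    obtain ⟨hm₁, hm₂⟩ := mem_formulaNodes_of_imp hm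
    simp only [code, tag_pair, lhs_pair_pair, rhs_pair_pair, code_mem_trueCandidates hm₁,
      code_mem_trueCandidates hm₂]
    simp [Formula.Realize]

theorem diagram_trueCandidates {φ : L.Formula ℕ} (hφ : φ.IsQF) (v : ℕ → M) :
    Diagram (LHom.id L) (code φ) (trueCandidates L v (code φ)) M (valueOfCode L v) where
  equal s hs t ht := by
    have hcandidate : equalCode s t ∈ candidates (code φ) :=
      List.mem_append_right _ (List.mem_flatMap.2 ⟨s, hs, List.mem_map.2 ⟨t, ht, rfl⟩⟩)
    rw [mem_trueCandidates, and_iff_right hcandidate]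
    obtain ⟨s, rfl⟩ := exists_term_of_mem_termNodes hφ hs
    obtain ⟨t, rfl⟩ := exists_term_of_mem_termNodes hφ ht
    rw [valueOfCode_termCode, valueOfCode_termCode]
    exact (holdsCode_code (v := v) (.equal s t)).symm
  func k f ts _ := by
    simp only [valueOfCode_termCode]
    rfl
  rel k R ts h := by
    rw [code_mem_trueCandidates h]
    simp only [valueOfCode_termCode]
    rfl

variable {A : List ℕ} {n : ℕ} {w : ℕ → M}

/-- The assignment that gives each variable the value of the subterm it is. -/
def variableValues (L : FirstOrder.Language.{0, 0}) [Encodable (Σ n, L.Functions n)]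
    (w : ℕ → M) (i : ℕ) : M :=
  w (termCode (Term.var (Sum.inl i) : L.Term (ℕ ⊕ Fin 0)))

theorem Diagram.realize_term (hw : Diagram (LHom.id L) n A M w) {t : L.Term (ℕ ⊕ Fin 0)}
    (ht : termCode t ∈ termNodes n) :
    t.realize (Sum.elim (variableValues L w) default) = w (termCode t) := by
  induction t with
  | var x =>
    rcases x with x | x
    exacts [rfl, x.elim0]
  | func f ts ih =>
    refine Eq.trans ?_ (hw.func _ f ts ht).symm
    exact congrArg (Structure.funMap f) (funext fun i => ih i (mem_termNodes_of_func ht i))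

theorem Diagram.realize_iff_mem (hw : Diagram (LHom.id L) n A M w) (hA : IsTruthSet n A)
    {ψ : L.Formula ℕ} (hψ : ψ.IsQF) (hmem : code ψ ∈ formulaNodes n) :
    ψ.Realize (variableValues L w) ↔ code ψ ∈ A := by
  induction hψ with
  | falsum =>
    have hnot := (hA.2 _ hmem).1 (by simp [code])
    simp [hnot, Formula.Realize, BoundedFormula.Realize]
  | of_isAtomic h =>
    cases h with
    | equal s t =>
      obtain ⟨hs, ht⟩ := mem_termNodes_of_equal hmem
      refine Iff.trans ?_ (hw.equal _ hs _ ht)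
      rw [← hw.realize_term hs, ← hw.realize_term ht]
      rfl
    | rel R ts =>
      refine Iff.trans ?_ (hw.rel _ R ts hmem)
      simp only [← hw.realize_term (mem_termNodes_of_rel hmem _)]
      rfl
  | @imp φ₁ φ₂ _ _ ih₁ ih₂ =>
    obtain ⟨hmem₁, hmem₂⟩ := mem_formulaNodes_of_imp hmem
    rw [(hA.2 _ hmem).2 (by simp [code])]
    simp only [code, lhs_pair_pair, rhs_pair_pair, ← ih₁ hmem₁, ← ih₂ hmem₂]
    rfl

theorem Diagram.realize {φ : L.Formula ℕ} (hw : Diagram (LHom.id L) (code φ) A M w)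
    (hφ : φ.IsQF) (hA : IsTruthSet (code φ) A) : φ.Realize (variableValues L w) :=
  (hw.realize_iff_mem hA hφ (self_mem_formulaNodes _)).2 hA.1

end Guesses

/-! ### Diagrams as cubes -/

/-- The code of the equation between two variables. -/
def varEqualCode (i j : ℕ) : ℕ := equalCode (Nat.pair 0 i) (Nat.pair 0 j)

/-- The code of the negation of the formula with the given code. -/
def notCode (c : ℕ) : ℕ := Nat.pair 3 (Nat.pair c (Nat.pair 0 0))

/-- The code of an application of the symbol with number `e` to variables. -/
def applyCode (e : ℕ) (l : List ℕ) : ℕ :=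
  Nat.pair 2 (Nat.pair e (Encodable.encode (l.map (Nat.pair 0))))

/-- The code of the conjunction of the formulas with the given codes. The innermost conjunct is a
trivial equation, because a cube has at least one literal. -/
def conjCode (l : List ℕ) : ℕ :=
  l.foldr (fun c acc => notCode (Nat.pair 3 (Nat.pair c (notCode acc)))) (varEqualCode 0 0)

/-- The code `c` or its negation, according to whether `b` belongs to the guess. -/
def signedCode (A : List ℕ) (b c : ℕ) : ℕ := if b ∈ A then c else notCode c

/-- The arrangement of the variables that stand for the subterms: the subterm with code `m` is
represented by the variable number `m`. -/
def equalLiterals (n : ℕ) (A : List ℕ) : List ℕ :=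
  (termNodes n).flatMap fun s =>
    (termNodes n).map fun t => signedCode A (equalCode s t) (varEqualCode s t)

/-- The equations that define the values of those subterms whose outermost symbol is in the
domain of the translation `d` of symbol numbers. -/
def funcLiterals (d : ℕ → Option ℕ) (n : ℕ) : List ℕ :=
  ((termNodes n).filter fun m => tag m = 2).filterMap fun m =>
    (d (lhs m)).map fun e => equalCode (Nat.pair 0 m) (applyCode e (args m))

/-- The literals on those predicate symbols that are in the domain of the translation `d`. -/
def relLiterals (d : ℕ → Option ℕ) (n : ℕ) (A : List ℕ) : List ℕ :=
  ((formulaNodes n).filter fun m => tag m = 2).filterMap fun m =>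
    (d (lhs m)).map fun e => signedCode A m (applyCode e (args m))

/-- The literals whose conjunction expresses the diagram of the guess `A`. -/
def diagramLiterals (d : ℕ → Option ℕ) (n : ℕ) (A : List ℕ) : List ℕ :=
  equalLiterals n A ++ funcLiterals d n ++ relLiterals d n A

/-- The literals saying that `j` variables, none of which stands for a subterm, are distinct. -/
def distinctLiterals (j : ℕ) : List ℕ :=
  (List.range j).flatMap fun a =>
    (List.range a).map fun b => notCode (varEqualCode (Nat.pair 1 a) (Nat.pair 1 b))

/-- The code of the cube saying that the diagram of the guess `A` holds and that there are at
least `j` elements. -/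
def cubeCode (d : ℕ → Option ℕ) (j n : ℕ) (A : List ℕ) : ℕ :=
  conjCode (diagramLiterals d n A ++ distinctLiterals j)

/-- The partial function `d` on symbol numbers is inverse to the language map `ι`. -/
structure IsTranslation {L L' : FirstOrder.Language.{0, 0}} [Encodable (Σ n, L.Functions n)]
    [Encodable (Σ n, L.Relations n)] [Encodable (Σ n, L'.Functions n)]
    [Encodable (Σ n, L'.Relations n)] (ι : L' →ᴸ L) (d : ℕ → Option ℕ) : Prop where
  func : ∀ {k : ℕ} (F : L.Functions k) (e : ℕ),
    d (Encodable.encode (⟨k, F⟩ : Σ n, L.Functions n)) = some e ↔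
      ∃ f : L'.Functions k, ι.onFunction f = F ∧
        Encodable.encode (⟨k, f⟩ : Σ n, L'.Functions n) = e
  rel : ∀ {k : ℕ} (R : L.Relations k) (e : ℕ),
    d (Encodable.encode (⟨k, R⟩ : Σ n, L.Relations n)) = some e ↔
      ∃ r : L'.Relations k, ι.onRelation r = R ∧
        Encodable.encode (⟨k, r⟩ : Σ n, L'.Relations n) = e

theorem IsCube.isQF {L : FirstOrder.Language.{0, 0}} {φ : L.Formula ℕ} (h : IsCube φ) :
    φ.IsQF := by
  induction h with
  | literal h =>
    rcases h with h | ⟨ψ, h, rfl⟩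
    exacts [h.isQF, h.isQF.not]
  | conj _ _ h₁ h₂ => exact h₁.inf h₂

section Literals
variable {L : FirstOrder.Language.{0, 0}}

variable (L) in
/-- The equation between two variables. -/
def varEqual (i j : ℕ) : L.Formula ℕ :=
  Term.bdEqual (.var (Sum.inl i)) (.var (Sum.inl j))

/-- The equation between a variable and the value of a function symbol at variables. -/
def funcEqual (i : ℕ) {k : ℕ} (f : L.Functions k) (l : Fin k → ℕ) : L.Formula ℕ :=
  Term.bdEqual (.var (Sum.inl i)) (.func f fun i => .var (Sum.inl (l i)))

/-- The application of a predicate symbol to variables. -/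
def relApply {k : ℕ} (R : L.Relations k) (l : Fin k → ℕ) : L.Formula ℕ :=
  R.boundedFormula fun i => .var (Sum.inl (l i))

variable [Encodable (Σ n, L.Functions n)] [Encodable (Σ n, L.Relations n)]

theorem code_varEqual (i j : ℕ) : code (varEqual L i j) = varEqualCode i j := rfl

theorem code_not (ψ : L.Formula ℕ) : code (Formula.not ψ) = notCode (code ψ) := rfl

theorem code_inf (φ ψ : L.Formula ℕ) :
    code (φ ⊓ ψ) = notCode (Nat.pair 3 (Nat.pair (code φ) (notCode (code ψ)))) := rfl

theorem code_funcEqual (i : ℕ) {k : ℕ} (f : L.Functions k) (l : Fin k → ℕ) :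
    code (funcEqual i f l) = equalCode (Nat.pair 0 i)
      (applyCode (Encodable.encode (⟨k, f⟩ : Σ n, L.Functions n)) (List.ofFn l)) := by
  simp only [funcEqual, Term.bdEqual, code, termCode, equalCode, applyCode, List.map_ofFn]
  rfl

theorem code_relApply {k : ℕ} (R : L.Relations k) (l : Fin k → ℕ) :
    code (relApply R l) =
      applyCode (Encodable.encode (⟨k, R⟩ : Σ n, L.Relations n)) (List.ofFn l) := by
  simp only [relApply, Relations.boundedFormula, code, termCode, applyCode, List.map_ofFn]
  rfl

variable (L) in
/-- The number `c` is the code of an `L`-literal. -/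
def IsLiteralCode (c : ℕ) : Prop := ∃ ψ : L.Formula ℕ, IsLiteral ψ ∧ code ψ = c

theorem isLiteralCode_signedCode {ψ : L.Formula ℕ} (h : ψ.IsAtomic) (A : List ℕ) (b : ℕ) :
    IsLiteralCode L (signedCode A b (code ψ)) := by
  unfold signedCode
  split_ifs
  exacts [⟨ψ, Or.inl h, rfl⟩, ⟨_, Or.inr ⟨ψ, h, rfl⟩, rfl⟩]

theorem exists_isCube_code_eq_conjCode {l : List ℕ} (h : ∀ c ∈ l, IsLiteralCode L c) :
    ∃ Ψ : L.Formula ℕ, IsCube Ψ ∧ code Ψ = conjCode l := by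
  induction l with
  | nil => exact ⟨varEqual L 0 0, .literal (Or.inl (.equal _ _)), rfl⟩
  | cons c l ih =>
    obtain ⟨Ψ, hΨ, hcode⟩ := ih fun c hc => h c (List.mem_cons_of_mem _ hc)
    obtain ⟨ψ, hψ, rfl⟩ := h c List.mem_cons_self
    exact ⟨ψ ⊓ Ψ, .conj (.literal hψ) hΨ, by rw [code_inf, hcode]; rfl⟩

variable {M : Type*} [L.Structure M] {w : ℕ → M}

theorem holdsCode_signedCode {A : List ℕ} {b : ℕ} {ψ : L.Formula ℕ} :
    HoldsCode L w (signedCode A b (code ψ)) ↔ (ψ.Realize w ↔ b ∈ A) := by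
  unfold signedCode
  split_ifs with h
  · simp [holdsCode_code, h]
  · simp [← code_not, holdsCode_code, h]

theorem holdsCode_conjCode {l : List ℕ} (h : ∀ c ∈ l, IsLiteralCode L c) :
    HoldsCode L w (conjCode l) ↔ ∀ c ∈ l, HoldsCode L w c := by
  induction l with
  | nil =>
    refine iff_of_true ((holdsCode_code (varEqual L 0 0)).2 ?_) (by simp)
    exact (rfl : w 0 = w 0)
  | cons c l ih =>
    have hl : ∀ c ∈ l, IsLiteralCode L c := fun c hc => h c (List.mem_cons_of_mem _ hc)
    obtain ⟨Ψ, -, hΨ⟩ := exists_isCube_code_eq_conjCode hl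
    obtain ⟨ψ, -, rfl⟩ := h c List.mem_cons_self
    have hinf : conjCode (code ψ :: l) = code (ψ ⊓ Ψ) := by rw [code_inf, hΨ]; rfl
    rw [hinf, List.forall_mem_cons, ← ih hl, ← hΨ, holdsCode_code, holdsCode_code, holdsCode_code,
      Formula.realize_inf]

end Literals

section DiagramLiterals
variable {L : FirstOrder.Language.{0, 0}} [Encodable (Σ n, L.Functions n)]
  [Encodable (Σ n, L.Relations n)] {L' : FirstOrder.Language.{0, 0}}
  [Encodable (Σ n, L'.Functions n)] [Encodable (Σ n, L'.Relations n)] {ι : L' →ᴸ L}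
  {d : ℕ → Option ℕ} {φ : L.Formula ℕ}

theorem mem_funcLiterals (hd : IsTranslation ι d) (hφ : φ.IsQF) {c : ℕ} :
    c ∈ funcLiterals d (code φ) ↔
      ∃ (k : ℕ) (f : L'.Functions k) (ts : Fin k → L.Term (ℕ ⊕ Fin 0)),
        termCode (Term.func (ι.onFunction f) ts) ∈ termNodes (code φ) ∧
        c = code (funcEqual (termCode (Term.func (ι.onFunction f) ts)) f
          fun i => termCode (ts i)) := by
  simp only [funcLiterals, List.mem_filterMap, List.mem_filter, decide_eq_true_eq,
    Option.map_eq_some_iff]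
  constructor
  · rintro ⟨m, ⟨hm, htag⟩, e, he, rfl⟩
    obtain ⟨k, F, ts, rfl⟩ := exists_func_of_mem_termNodes hφ hm htag
    simp only [termCode, lhs_pair_pair] at he
    obtain ⟨f, rfl, rfl⟩ := (hd.func _ _).1 he
    exact ⟨k, f, ts, hm, by rw [code_funcEqual]; simp [termCode]⟩
  · rintro ⟨k, f, ts, hm, rfl⟩
    refine ⟨_, ⟨hm, by simp [termCode]⟩,
      Encodable.encode (⟨k, f⟩ : Σ n, L'.Functions n), ?_, ?_⟩
    · simp only [termCode, lhs_pair_pair]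
      exact (hd.func _ _).2 ⟨f, rfl, rfl⟩
    · rw [code_funcEqual]
      simp [termCode]

theorem mem_relLiterals (hd : IsTranslation ι d) (hφ : φ.IsQF) {A : List ℕ} {c : ℕ} :
    c ∈ relLiterals d (code φ) A ↔
      ∃ (k : ℕ) (R : L'.Relations k) (ts : Fin k → L.Term (ℕ ⊕ Fin 0)),
        code (BoundedFormula.rel (ι.onRelation R) ts : L.Formula ℕ) ∈ formulaNodes (code φ) ∧
        c = signedCode A (code (BoundedFormula.rel (ι.onRelation R) ts : L.Formula ℕ))
          (code (relApply R fun i => termCode (ts i))) := by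
  simp only [relLiterals, List.mem_filterMap, List.mem_filter, decide_eq_true_eq,
    Option.map_eq_some_iff]
  constructor
  · rintro ⟨m, ⟨hm, htag⟩, e, he, rfl⟩
    obtain ⟨k, R, ts, rfl⟩ := exists_rel_of_mem_formulaNodes hφ hm htag
    simp only [code, lhs_pair_pair] at he
    obtain ⟨R, rfl, rfl⟩ := (hd.rel _ _).1 he
    exact ⟨k, R, ts, hm, by rw [code_relApply]; simp [code]⟩
  · rintro ⟨k, R, ts, hm, rfl⟩
    refine ⟨_, ⟨hm, by simp [code]⟩,
      Encodable.encode (⟨k, R⟩ : Σ n, L'.Relations n), ?_, ?_⟩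
    · simp only [code, lhs_pair_pair]
      exact (hd.rel _ _).2 ⟨R, rfl, rfl⟩
    · rw [code_relApply]
      simp [code]

theorem forall_mem_diagramLiterals (hd : IsTranslation ι d) (hφ : φ.IsQF) {A : List ℕ}
    {p : ℕ → Prop} : (∀ c ∈ diagramLiterals d (code φ) A, p c) ↔
      (∀ s ∈ termNodes (code φ), ∀ t ∈ termNodes (code φ),
        p (signedCode A (equalCode s t) (code (varEqual L' s t)))) ∧
      (∀ (k : ℕ) (f : L'.Functions k) (ts : Fin k → L.Term (ℕ ⊕ Fin 0)),
        termCode (Term.func (ι.onFunction f) ts) ∈ termNodes (code φ) →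
        p (code (funcEqual (termCode (Term.func (ι.onFunction f) ts)) f
          fun i => termCode (ts i)))) ∧
      ∀ (k : ℕ) (R : L'.Relations k) (ts : Fin k → L.Term (ℕ ⊕ Fin 0)),
        code (BoundedFormula.rel (ι.onRelation R) ts : L.Formula ℕ) ∈ formulaNodes (code φ) →
        p (signedCode A (code (BoundedFormula.rel (ι.onRelation R) ts : L.Formula ℕ))
          (code (relApply R fun i => termCode (ts i)))) := by
  simp only [diagramLiterals, List.forall_mem_append, and_assoc]
  refine and_congr ?_ (and_congr ?_ ?_)
  · simp only [equalLiterals, List.forall_mem_flatMap, List.forall_mem_map, code_varEqual]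
  · simp only [mem_funcLiterals hd hφ]
    exact ⟨fun h k f ts hm => h _ ⟨k, f, ts, hm, rfl⟩,
      fun h c ⟨k, f, ts, hm, hc⟩ => hc ▸ h k f ts hm⟩
  · simp only [mem_relLiterals hd hφ]
    exact ⟨fun h k R ts hm => h _ ⟨k, R, ts, hm, rfl⟩,
      fun h c ⟨k, R, ts, hm, hc⟩ => hc ▸ h k R ts hm⟩

theorem isLiteralCode_of_mem_diagramLiterals (hd : IsTranslation ι d) (hφ : φ.IsQF)
    (A : List ℕ) : ∀ c ∈ diagramLiterals d (code φ) A, IsLiteralCode L' c :=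
  (forall_mem_diagramLiterals hd hφ).2
    ⟨fun _ _ _ _ => isLiteralCode_signedCode (.equal _ _) _ _,
      fun _ _ _ _ => ⟨_, Or.inl (.equal _ _), rfl⟩,
      fun _ _ _ _ => isLiteralCode_signedCode (.rel _ _) _ _⟩

theorem forall_mem_distinctLiterals {j : ℕ} {p : ℕ → Prop} :
    (∀ c ∈ distinctLiterals j, p c) ↔ ∀ a < j, ∀ b < a,
      p (code (Formula.not (varEqual L (Nat.pair 1 a) (Nat.pair 1 b)))) := by
  simp only [distinctLiterals, List.forall_mem_flatMap, List.forall_mem_map, List.mem_range,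
    code_not, code_varEqual]

theorem isLiteralCode_of_mem_distinctLiterals (j : ℕ) :
    ∀ c ∈ distinctLiterals j, IsLiteralCode L c :=
  forall_mem_distinctLiterals.2 fun _ _ _ _ => ⟨_, Or.inr ⟨_, .equal _ _, rfl⟩, rfl⟩

theorem isLiteralCode_of_mem_append (hd : IsTranslation ι d) (hφ : φ.IsQF) (A : List ℕ) (j : ℕ) :
    ∀ c ∈ diagramLiterals d (code φ) A ++ distinctLiterals j, IsLiteralCode L' c :=
  List.forall_mem_append.2 ⟨isLiteralCode_of_mem_diagramLiterals hd hφ A,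
    isLiteralCode_of_mem_distinctLiterals j⟩

theorem exists_isCube_code_eq_cubeCode (hd : IsTranslation ι d) (hφ : φ.IsQF) (A : List ℕ)
    (j : ℕ) : ∃ Ψ : L'.Formula ℕ, IsCube Ψ ∧ code Ψ = cubeCode d j (code φ) A :=
  exists_isCube_code_eq_conjCode (isLiteralCode_of_mem_append hd hφ A j)

variable {M : Type*} [L'.Structure M] {w : ℕ → M}

theorem forall_mem_diagramLiterals_holdsCode (hd : IsTranslation ι d) (hφ : φ.IsQF)
    {A : List ℕ} : (∀ c ∈ diagramLiterals d (code φ) A, HoldsCode L' w c) ↔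
      Diagram ι (code φ) A M w := by
  simp only [forall_mem_diagramLiterals hd hφ, holdsCode_signedCode, holdsCode_code]
  exact ⟨fun ⟨hequal, hfunc, hrel⟩ => ⟨hequal, hfunc, hrel⟩,
    fun h => ⟨h.equal, h.func, h.rel⟩⟩

theorem holdsCode_cubeCode (hd : IsTranslation ι d) (hφ : φ.IsQF) {A : List ℕ} {j : ℕ} :
    HoldsCode L' w (cubeCode d j (code φ) A) ↔ Diagram ι (code φ) A M w ∧
      ∀ a < j, ∀ b < a, w (Nat.pair 1 a) ≠ w (Nat.pair 1 b) := by
  rw [cubeCode, holdsCode_conjCode (isLiteralCode_of_mem_append hd hφ A j),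
    List.forall_mem_append, forall_mem_diagramLiterals_holdsCode hd hφ,
    forall_mem_distinctLiterals (L := L')]
  simp only [holdsCode_code]
  rfl

end DiagramLiterals

/-! ### Computability of the syntactic operations -/

section Recursiveness
variable {α β : Type*} [Primcodable α] [Primcodable β]

theorem primrecRel_mem : PrimrecRel fun (a : α) (l : List α) => a ∈ l := by
  have : PrimrecRel fun (l : List α) (a : α) => ∃ b ∈ l, b = a :=
    PrimrecRel.exists_mem_list Primrec.eq
  exact this.swap.of_eq fun a l => by simp

theorem primrecPred_imp {p q : α → Prop} (hp : PrimrecPred p) (hq : PrimrecPred q) :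
    PrimrecPred fun a => p a → q a :=
  (hp.not.or hq).of_eq fun _ => imp_iff_not_or.symm

theorem primrecPred_iff {p q : α → Prop} (hp : PrimrecPred p) (hq : PrimrecPred q) :
    PrimrecPred fun a => p a ↔ q a :=
  ((primrecPred_imp hp hq).and (primrecPred_imp hq hp)).of_eq fun _ => iff_def.symm

theorem primrecPred_forall_mem {l : α → List β} {R : β → α → Prop} (hl : Primrec l)
    (hR : PrimrecRel R) : PrimrecPred fun a => ∀ b ∈ l a, R b a :=
  (PrimrecRel.forall_mem_list hR).comp hl .id

theorem primrec_sublists' : Primrec (List.sublists' : List α → List (List α)) := by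
  have h : Primrec fun l : List α =>
      l.foldr (fun a acc => acc ++ acc.map (List.cons a)) [ [] ] := by
    refine Primrec.list_foldr (f := fun l : List α => l)
      (h := fun _ (x : α × List (List α)) => x.2 ++ x.2.map (List.cons x.1)) .id (.const _) ?_
    refine Primrec.list_append.comp (Primrec.snd.comp .snd) ?_
    exact Primrec.list_map (Primrec.snd.comp .snd)
      (Primrec.list_cons.comp (Primrec.fst.comp (Primrec.snd.comp .fst)) .snd)
  refine h.of_eq fun l => ?_
  induction l with
  | nil => rfl
  | cons a l ih => rw [List.foldr_cons, ih, List.sublists'_cons]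

theorem natRec_or_getElem?_eq_any_take {β : Type*} (p : β → Bool) (l : List β) (k : ℕ)
    (hk : k ≤ l.length) :
    Nat.rec (motive := fun _ => Bool) false
      (fun i b => b || ((l[i]?).map p).getD false) k = (l.take k).any p := by
  induction k with
  | zero => simp
  | succ k ih =>
    have hlt : k < l.length := by omega
    rw [List.take_succ_eq_append_getElem hlt, List.any_append, ← ih hlt.le]
    simp [List.getElem?_eq_getElem hlt]

theorem computable_any {l : α → List β} {p : α → β → Bool} (hl : Computable l)
    (hp : Computable₂ p) : Computable fun a => (l a).any (p a) := by
  have h : Computable fun a => Nat.rec (motive := fun _ => Bool) false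
      (fun i b => b || (((l a)[i]?).map (p a)).getD false) (l a).length := by
    refine Computable.nat_rec (h := fun a x => x.2 || (((l a)[x.1]?).map (p a)).getD false)
      (Computable.list_length.comp hl) (.const _) ?_
    refine Primrec.or.to_comp.comp (Computable.snd.comp .snd) ?_
    refine Computable.option_getD (Computable.option_map ?_ ?_) (.const _)
    · exact Computable.list_getElem?.comp (hl.comp .fst) (Computable.fst.comp .snd)
    · exact hp.comp (Computable.fst.comp .fst) .snd
  exact h.of_eq fun a => by
    rw [natRec_or_getElem?_eq_any_take (p a) (l a) _ le_rfl, List.take_length]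

end Recursiveness

theorem primrec_tag : Primrec tag := Primrec.fst.comp .unpair

theorem primrec_lhs : Primrec lhs :=
  Primrec.fst.comp (Primrec.unpair.comp (Primrec.snd.comp .unpair))

theorem primrec_rhs : Primrec rhs :=
  Primrec.snd.comp (Primrec.unpair.comp (Primrec.snd.comp .unpair))

theorem primrec_args : Primrec args := (Primrec.ofNat (List ℕ)).comp primrec_rhs

theorem primrec_constituents : Primrec constituents := by
  have htag (k : ℕ) : PrimrecPred fun x : Bool × ℕ => tag x.2 = k :=
    Primrec.eq.comp (primrec_tag.comp .snd) (.const k)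
  have hfst : PrimrecPred fun x : Bool × ℕ => x.1 = true := Primrec.eq.comp .fst (.const true)
  have hpair (b : Bool) : Primrec fun x : Bool × ℕ => [(b, lhs x.2), (b, rhs x.2)] :=
    Primrec.list_cons.comp (.pair (.const b) (primrec_lhs.comp .snd))
      (Primrec.list_cons.comp (.pair (.const b) (primrec_rhs.comp .snd)) (.const []))
  exact .ite (htag 2)
    (Primrec.list_map (primrec_args.comp .snd) (Primrec.pair (.const false) .snd))
    (.ite (hfst.and (htag 1)) (hpair false) (.ite (hfst.and (htag 3)) (hpair true) (.const [])))

theorem primrec_descendants {α : Type*} [Primcodable α] {step : α → List α} (h : Primrec step) :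
    Primrec₂ (descendants step) := by
  refine Primrec.nat_iterate (f := fun x : ℕ × α => x.1) (g := fun x => [x.2])
    (h := fun _ l => l ++ l.flatMap step) .fst
    (Primrec.list_cons.comp .snd (.const [])) ?_
  exact Primrec.list_append.comp .snd (Primrec.list_flatMap .snd (h.comp .snd))

theorem primrec_nodes : Primrec nodes :=
  (primrec_descendants primrec_constituents).comp .succ (.pair (.const true) .id)

theorem primrec_termNodes : Primrec termNodes :=
  Primrec.list_map
    ((Primrec.listFilter (Primrec.eq.comp .fst (.const false))).comp primrec_nodes)
    (Primrec.snd.comp .snd)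

theorem primrec_formulaNodes : Primrec formulaNodes :=
  Primrec.list_map
    ((Primrec.listFilter (Primrec.eq.comp .fst (.const true))).comp primrec_nodes)
    (Primrec.snd.comp .snd)

theorem primrec_equalCode : Primrec₂ equalCode :=
  Primrec₂.natPair.comp (.const 1) Primrec₂.natPair

theorem primrec_candidates : Primrec candidates :=
  Primrec.list_append.comp primrec_formulaNodes <|
    Primrec.list_flatMap primrec_termNodes <|
      Primrec.list_map (primrec_termNodes.comp .fst)
        (primrec_equalCode.comp (Primrec.snd.comp .fst) .snd)

theorem primrec_guesses : Primrec guesses := primrec_sublists'.comp primrec_candidates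

theorem primrecRel_isTruthSet : PrimrecRel IsTruthSet := by
  have hA : Primrec fun x : ℕ × ℕ × List ℕ => x.2.2 := Primrec.snd.comp .snd
  have hm := primrecRel_mem.comp .fst hA
  have hl := primrecRel_mem.comp (primrec_lhs.comp .fst) hA
  have hr := primrecRel_mem.comp (primrec_rhs.comp .fst) hA
  have htag (k : ℕ) : PrimrecPred fun x : ℕ × ℕ × List ℕ => tag x.1 = k :=
    Primrec.eq.comp (primrec_tag.comp .fst) (.const k)
  have h : PrimrecRel fun (m : ℕ) (p : ℕ × List ℕ) => (tag m = 0 → m ∉ p.2) ∧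
      (tag m = 3 → (m ∈ p.2 ↔ (lhs m ∈ p.2 → rhs m ∈ p.2))) := by
    refine (primrecPred_imp (htag 0) hm.not).and (primrecPred_imp (htag 3) ?_)
    exact primrecPred_iff hm (primrecPred_imp hl hr)
  exact (primrecRel_mem.comp .fst .snd).and
    (primrecPred_forall_mem (primrec_formulaNodes.comp .fst) h)

theorem primrec_varEqualCode : Primrec₂ varEqualCode :=
  primrec_equalCode.comp (Primrec₂.natPair.comp (.const 0) .fst)
    (Primrec₂.natPair.comp (.const 0) .snd)

theorem primrec_notCode : Primrec notCode :=
  Primrec₂.natPair.comp (.const 3) (Primrec₂.natPair.comp .id (.const _))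

theorem primrec_applyCode : Primrec₂ applyCode :=
  Primrec₂.natPair.comp (.const 2) <| Primrec₂.natPair.comp .fst <| Primrec.encode.comp <|
    Primrec.list_map .snd (Primrec₂.natPair.comp (.const 0) .snd)

theorem primrec_conjCode : Primrec conjCode := by
  refine Primrec.list_foldr (f := fun l : List ℕ => l)
    (h := fun _ (x : ℕ × ℕ) => notCode (Nat.pair 3 (Nat.pair x.1 (notCode x.2)))) .id (.const _) ?_
  refine primrec_notCode.comp (Primrec₂.natPair.comp (.const 3) ?_)
  exact Primrec₂.natPair.comp (Primrec.fst.comp .snd)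
    (primrec_notCode.comp (Primrec.snd.comp .snd))

theorem primrec_signedCode {α : Type*} [Primcodable α] {A : α → List ℕ} {b c : α → ℕ}
    (hA : Primrec A) (hb : Primrec b) (hc : Primrec c) :
    Primrec fun x => signedCode (A x) (b x) (c x) :=
  .ite (primrecRel_mem.comp hb hA) hc (primrec_notCode.comp hc)

theorem primrec_equalLiterals : Primrec₂ equalLiterals := by
  refine Primrec.list_flatMap (primrec_termNodes.comp .fst) ?_
  refine Primrec.list_map (primrec_termNodes.comp (Primrec.fst.comp .fst)) ?_
  have hs : Primrec fun x : ((ℕ × List ℕ) × ℕ) × ℕ => x.1.2 := Primrec.snd.comp .fst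
  exact primrec_signedCode (Primrec.snd.comp (Primrec.fst.comp .fst))
    (primrec_equalCode.comp hs .snd) (primrec_varEqualCode.comp hs .snd)

theorem primrec_tag_filter : Primrec fun l : List ℕ => l.filter fun m => tag m = 2 :=
  Primrec.listFilter (Primrec.eq.comp primrec_tag (.const 2))

theorem primrec_funcLiterals {d : ℕ → Option ℕ} (hd : Primrec d) : Primrec (funcLiterals d) := by
  refine Primrec.listFilterMap (primrec_tag_filter.comp primrec_termNodes) ?_
  refine Primrec.option_map (hd.comp (primrec_lhs.comp .snd)) ?_
  have hm : Primrec fun x : (ℕ × ℕ) × ℕ => x.1.2 := Primrec.snd.comp .fst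
  exact primrec_equalCode.comp (Primrec₂.natPair.comp (.const 0) hm)
    (primrec_applyCode.comp .snd (primrec_args.comp hm))

theorem primrec_relLiterals {d : ℕ → Option ℕ} (hd : Primrec d) : Primrec₂ (relLiterals d) := by
  refine Primrec.listFilterMap (primrec_tag_filter.comp (primrec_formulaNodes.comp .fst)) ?_
  refine Primrec.option_map (hd.comp (primrec_lhs.comp .snd)) ?_
  have hm : Primrec fun x : ((ℕ × List ℕ) × ℕ) × ℕ => x.1.2 := Primrec.snd.comp .fst
  exact primrec_signedCode (Primrec.snd.comp (Primrec.fst.comp .fst)) hm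
    (primrec_applyCode.comp .snd (primrec_args.comp hm))

theorem primrec_distinctLiterals : Primrec distinctLiterals := by
  refine Primrec.list_flatMap Primrec.list_range ?_
  refine Primrec.list_map (Primrec.list_range.comp .snd) ?_
  exact primrec_notCode.comp <| primrec_varEqualCode.comp
    (Primrec₂.natPair.comp (.const 1) (Primrec.snd.comp .fst))
    (Primrec₂.natPair.comp (.const 1) .snd)

theorem primrec_diagramLiterals {d : ℕ → Option ℕ} (hd : Primrec d) :
    Primrec₂ (diagramLiterals d) :=
  Primrec.list_append.comp (Primrec.list_append.comp primrec_equalLiterals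
    ((primrec_funcLiterals hd).comp .fst)) (primrec_relLiterals hd)

theorem primrec_cubeCode {d : ℕ → Option ℕ} (hd : Primrec d) {α : Type*} [Primcodable α]
    {j n : α → ℕ} {A : α → List ℕ} (hj : Primrec j) (hn : Primrec n) (hA : Primrec A) :
    Primrec fun x => cubeCode d (j x) (n x) (A x) :=
  primrec_conjCode.comp <| Primrec.list_append.comp ((primrec_diagramLiterals hd).comp hn hA)
    (primrec_distinctLiterals.comp hj)

theorem computable_exists_guess {α : Type*} [Primcodable α] {n : α → ℕ}
    {test : α → List ℕ → Bool} (hn : Computable n) (htest : Computable₂ test) :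
    ∃ f : α → Bool, Computable f ∧ ∀ a, f a = true ↔
      ∃ A ∈ guesses (n a), IsTruthSet (n a) A ∧ test a A = true := by
  classical
  refine ⟨fun a => (guesses (n a)).any fun A => decide (IsTruthSet (n a) A) && test a A,
    computable_any (primrec_guesses.to_comp.comp hn) ?_, fun a => by simp⟩
  exact Primrec.and.to_comp.comp
    (primrecRel_isTruthSet.decide.to_comp.comp (hn.comp .fst) .snd) htest

/-! ### Translations between signatures -/

section Translations

theorem isTranslation_id {L : FirstOrder.Language.{0, 0}} [Encodable (Σ n, L.Functions n)]
    [Encodable (Σ n, L.Relations n)] : IsTranslation (LHom.id L) some where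
  func F e := by simp [LHom.id]
  rel R e := by simp [LHom.id]

/-- The partial function from the symbol numbers of a disjoint union of signatures to those of
its first summand (for `r = 0`) or of its second summand (for `r = 1`). -/
def summandNumber (r e : ℕ) : Option ℕ := if e % 2 = r then some (e / 2) else none

theorem primrec_summandNumber (r : ℕ) : Primrec (summandNumber r) :=
  .ite (Primrec.eq.comp (Primrec.nat_mod.comp .id (.const 2)) (.const r))
    (Primrec.option_some.comp (Primrec.nat_div.comp .id (.const 2))) (.const none)

theorem summandNumber_zero_eq_some {c e : ℕ} : summandNumber 0 c = some e ↔ c = 2 * e := by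
  grind [summandNumber]

theorem summandNumber_one_eq_some {c e : ℕ} : summandNumber 1 c = some e ↔ c = 2 * e + 1 := by
  grind [summandNumber]

variable {L₁ L₂ : FirstOrder.Language.{0, 0}}

section
variable [Encodable (Σ n, L₁.Functions n)] [Encodable (Σ n, L₂.Functions n)]

theorem encode_func_inl {k : ℕ} (f : L₁.Functions k) :
    Encodable.encode (⟨k, Sum.inl f⟩ : Σ n, (L₁.sum L₂).Functions n) =
      2 * Encodable.encode (⟨k, f⟩ : Σ n, L₁.Functions n) := rfl

theorem encode_func_inr {k : ℕ} (f : L₂.Functions k) :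
    Encodable.encode (⟨k, Sum.inr f⟩ : Σ n, (L₁.sum L₂).Functions n) =
      2 * Encodable.encode (⟨k, f⟩ : Σ n, L₂.Functions n) + 1 := rfl

end

section
variable [Encodable (Σ n, L₁.Relations n)] [Encodable (Σ n, L₂.Relations n)]

theorem encode_rel_inl {k : ℕ} (R : L₁.Relations k) :
    Encodable.encode (⟨k, Sum.inl R⟩ : Σ n, (L₁.sum L₂).Relations n) =
      2 * Encodable.encode (⟨k, R⟩ : Σ n, L₁.Relations n) := rfl

theorem encode_rel_inr {k : ℕ} (R : L₂.Relations k) :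
    Encodable.encode (⟨k, Sum.inr R⟩ : Σ n, (L₁.sum L₂).Relations n) =
      2 * Encodable.encode (⟨k, R⟩ : Σ n, L₂.Relations n) + 1 := rfl

end

variable [Encodable (Σ n, L₁.Functions n)] [Encodable (Σ n, L₁.Relations n)]
  [Encodable (Σ n, L₂.Functions n)] [Encodable (Σ n, L₂.Relations n)]

theorem isTranslation_sumInl :
    IsTranslation (LHom.sumInl : L₁ →ᴸ L₁.sum L₂) (summandNumber 0) where
  func F e := by
    rw [summandNumber_zero_eq_some]
    rcases F with f | f
    · rw [encode_func_inl]
      exact ⟨fun h => ⟨f, rfl, by omega⟩, fun ⟨_, h₁, h₂⟩ => by cases h₁; omega⟩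
    · rw [encode_func_inr]
      exact iff_of_false (by omega) fun ⟨_, h, _⟩ => Sum.inl_ne_inr h
  rel R e := by
    rw [summandNumber_zero_eq_some]
    rcases R with R | R
    · rw [encode_rel_inl]
      exact ⟨fun h => ⟨R, rfl, by omega⟩, fun ⟨_, h₁, h₂⟩ => by cases h₁; omega⟩
    · rw [encode_rel_inr]
      exact iff_of_false (by omega) fun ⟨_, h, _⟩ => Sum.inl_ne_inr h

theorem isTranslation_sumInr :
    IsTranslation (LHom.sumInr : L₂ →ᴸ L₁.sum L₂) (summandNumber 1) where
  func F e := by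
    rw [summandNumber_one_eq_some]
    rcases F with f | f
    · rw [encode_func_inl]
      exact iff_of_false (by omega) fun ⟨_, h, _⟩ => Sum.inr_ne_inl h
    · rw [encode_func_inr]
      exact ⟨fun h => ⟨f, rfl, by omega⟩, fun ⟨_, h₁, h₂⟩ => by cases h₁; omega⟩
  rel R e := by
    rw [summandNumber_one_eq_some]
    rcases R with R | R
    · rw [encode_rel_inl]
      exact iff_of_false (by omega) fun ⟨_, h, _⟩ => Sum.inr_ne_inl h
    · rw [encode_rel_inr]
      exact ⟨fun h => ⟨R, rfl, by omega⟩, fun ⟨_, h₁, h₂⟩ => by cases h₁; omega⟩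

end Translations

/-! ### Spectra of diagrams -/

theorem Satisfiable.spec_nonempty {L : FirstOrder.Language.{0, 0}}
    [Countable (Σ n, L.Functions n)] [Countable (Σ n, L.Relations n)] {T : L.Theory}
    {φ : L.Formula ℕ} (h : Satisfiable T φ) : (Spec T φ).Nonempty := by
  obtain ⟨M, _, v, hT, hφ⟩ := h
  rcases le_total #M ℵ₀ with hM | hM
  · exact ⟨_, hM, M, _, v, hT, hφ, rfl⟩
  have hL : L.card ≤ ℵ₀ := by
    have : Countable L.Symbols := inferInstanceAs (Countable (_ ⊕ _))
    exact Cardinal.mk_le_aleph0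
  obtain ⟨S, hS, hcard⟩ := exists_elementarySubstructure_card_eq L (Set.range v)
    (ℵ₀ : Cardinal.{0}) le_rfl
    (by simpa using (Set.countable_range v).le_aleph0) (by simpa using hL) (by simpa using hM)
  exact ⟨ℵ₀, le_rfl, S, inferInstance, fun i => ⟨v i, hS ⟨i, rfl⟩⟩, inferInstance,
    (S.subtype.map_formula φ _).1 hφ, by simpa using hcard⟩

theorem tag_termCode_ne_one {L : FirstOrder.Language.{0, 0}} [Encodable (Σ n, L.Functions n)]
    (t : L.Term (ℕ ⊕ Fin 0)) : tag (termCode t) ≠ 1 := by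
  rcases t with (x | x) | _
  · simp [termCode]
  · exact x.elim0
  · simp [termCode]

theorem natCast_le_mk_iff {M : Type*} [Nonempty M] {j : ℕ} :
    (j : Cardinal) ≤ #M ↔ ∃ g : ℕ → M, ∀ a < j, ∀ b < a, g a ≠ g b := by
  constructor
  · intro hj
    obtain ⟨g⟩ : Nonempty (ULift (Fin j) ↪ M) := by
      rw [← Cardinal.le_def]
      simpa using hj
    refine ⟨fun a => if ha : a < j then g ⟨a, ha⟩ else Classical.arbitrary M, ?_⟩
    intro a ha b hb
    simp [ha, hb.trans ha, hb.ne']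
  · rintro ⟨g, hg⟩
    have hinj : Function.Injective fun a : ULift (Fin j) => g a.down := by
      rintro ⟨a⟩ ⟨b⟩ hab
      rcases lt_trichotomy a b with hlt | rfl | hlt
      exacts [(hg b b.2 a hlt hab.symm).elim, rfl, (hg a a.2 b hlt hab).elim]
    simpa using Cardinal.mk_le_of_injective hinj

section DiagramSpectra
variable {L L' : FirstOrder.Language.{0, 0}} [Encodable (Σ n, L.Functions n)]
  [Encodable (Σ n, L.Relations n)] {ι : L' →ᴸ L}

theorem Diagram.map {n : ℕ} {A : List ℕ} {M N : Type*} [L'.Structure M] [L'.Structure N]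
    {w : ℕ → M} {w' : ℕ → N} (h : Diagram ι n A M w) (e : M ≃ N)
    (hw : ∀ s ∈ termNodes n, w' s = e (w s))
    (hfunc : ∀ (k : ℕ) (f : L'.Functions k) (ts : Fin k → L.Term (ℕ ⊕ Fin 0)),
      termCode (Term.func (ι.onFunction f) ts) ∈ termNodes n →
        ∀ y, e (Structure.funMap f y) = Structure.funMap f (e ∘ y))
    (hrel : ∀ (k : ℕ) (R : L'.Relations k) (ts : Fin k → L.Term (ℕ ⊕ Fin 0)),
      code (BoundedFormula.rel (ι.onRelation R) ts : L.Formula ℕ) ∈ formulaNodes n →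
        ∀ y, Structure.RelMap R (e ∘ y) ↔ Structure.RelMap R y) : Diagram ι n A N w' where
  equal s hs t ht := by rw [hw s hs, hw t ht, e.injective.eq_iff, h.equal s hs t ht]
  func k f ts hm := by
    simp only [hw _ hm, hw _ (mem_termNodes_of_func hm _), h.func k f ts hm]
    exact hfunc k f ts hm _
  rel k R ts hm := by
    simp only [hw _ (mem_termNodes_of_rel hm _)]
    exact (hrel k R ts hm _).trans (h.rel k R ts hm)

/-- The countable cardinalities of the models of `T` in which the diagram of the guess `A` for
the formula with code `n` holds for some values of the subterms. -/
def diagramSpec (T : L'.Theory) (ι : L' →ᴸ L) (n : ℕ) (A : List ℕ) : Set Cardinal.{0} :=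
  {κ | κ ≤ ℵ₀ ∧
    ∃ (M : Type) (_ : L'.Structure M) (w : ℕ → M), M ⊨ T ∧ Diagram ι n A M w ∧ #M = κ}

theorem mem_spec_iff {T : L.Theory} {φ : L.Formula ℕ} (hφ : φ.IsQF) {κ : Cardinal} :
    κ ∈ Spec T φ ↔ ∃ A ∈ guesses (code φ), IsTruthSet (code φ) A ∧
      κ ∈ diagramSpec T (LHom.id L) (code φ) A := by
  constructor
  · rintro ⟨hκ, M, _, v, hT, hv, hM⟩
    exact ⟨trueCandidates L v (code φ), trueCandidates_mem_guesses v _,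
      isTruthSet_trueCandidates hφ hv, hκ, M, _, _, hT, diagram_trueCandidates hφ v, hM⟩
  · rintro ⟨A, -, hA, hκ, M, _, w, hT, hw, hM⟩
    exact ⟨hκ, M, _, _, hT, hw.realize hφ hA, hM⟩

variable [Encodable (Σ n, L'.Functions n)] [Encodable (Σ n, L'.Relations n)]
  {d : ℕ → Option ℕ} {φ : L.Formula ℕ} {A : List ℕ} {j : ℕ} {T : L'.Theory} {Ψ : L'.Formula ℕ}

theorem realize_iff_of_code_eq_cubeCode (hd : IsTranslation ι d) (hφ : φ.IsQF)
    (hΨ : code Ψ = cubeCode d j (code φ) A) {M : Type*} [L'.Structure M] {w : ℕ → M} :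
    Ψ.Realize w ↔ Diagram ι (code φ) A M w ∧
      ∀ a < j, ∀ b < a, w (Nat.pair 1 a) ≠ w (Nat.pair 1 b) := by
  rw [← holdsCode_code, hΨ, holdsCode_cubeCode hd hφ]

theorem spec_eq_diagramSpec (hd : IsTranslation ι d) (hφ : φ.IsQF)
    (hΨ : code Ψ = cubeCode d 0 (code φ) A) : Spec T Ψ = diagramSpec T ι (code φ) A := by
  simp [Spec, diagramSpec, realize_iff_of_code_eq_cubeCode hd hφ hΨ]

theorem satisfiable_iff_exists_mem_diagramSpec (hd : IsTranslation ι d) (hφ : φ.IsQF)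
    (hΨ : code Ψ = cubeCode d j (code φ) A) :
    Satisfiable T Ψ ↔ ∃ κ ∈ diagramSpec T ι (code φ) A, (j : Cardinal) ≤ κ := by
  constructor
  · intro h
    obtain ⟨κ, hκ, M, _, w, hT, hw, rfl⟩ := h.spec_nonempty
    obtain ⟨hw, hj⟩ := (realize_iff_of_code_eq_cubeCode hd hφ hΨ).1 hw
    have : Nonempty M := ⟨w 0⟩
    exact ⟨#M, ⟨hκ, M, _, w, hT, hw, rfl⟩, natCast_le_mk_iff.2 ⟨_, hj⟩⟩
  · rintro ⟨κ, ⟨-, M, _, w, hT, hw, rfl⟩, hj⟩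
    have : Nonempty M := ⟨w 0⟩
    obtain ⟨g, hg⟩ := natCast_le_mk_iff.1 hj
    -- The codes of the form `Nat.pair 1 a` are not codes of subterms.
    let w' : ℕ → M := fun c => if tag c = 1 then g c.unpair.2 else w c
    refine ⟨M, _, w', hT, (realize_iff_of_code_eq_cubeCode hd hφ hΨ).2 ⟨?_, ?_⟩⟩
    · refine hw.map (.refl M) (fun s hs => ?_) (fun _ _ _ _ _ => rfl) fun _ _ _ _ _ => Iff.rfl
      obtain ⟨t, rfl⟩ := exists_term_of_mem_termNodes hφ hs
      simp [w', tag_termCode_ne_one t]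
    · simpa [w'] using hg

end DiagramSpectra

theorem exists_equiv_extending {α : Type*} {M : Type*} {N : Type*} (hMN : Nonempty (M ≃ N))
    {s : Set α} (hs : s.Finite) {w : α → M} {w' : α → N}
    (h : ∀ x ∈ s, ∀ y ∈ s, (w x = w y ↔ w' x = w' y)) :
    ∃ e : M ≃ N, ∀ x ∈ s, w' x = e (w x) := by
  have hS : (w '' s).Finite := hs.image w
  choose p hp hpw using fun a : w '' s => a.2
  let f : w '' s ↪ N := ⟨fun a => w' (p a), fun a b hab => by
    have := (h _ (hp a) _ (hp b)).2 hab
    rwa [hpw, hpw, ← Subtype.ext_iff] at this⟩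
  obtain ⟨e, he⟩ : ∃ e : M ≃ N, ∀ a : w '' s, e a = f a := by
    rcases finite_or_infinite M with hM | hM
    · exact Cardinal.extend_function_finite f hMN
    · refine Cardinal.extend_function_of_lt f ?_ hMN
      exact (Cardinal.lt_aleph0_iff_set_finite.2 hS).trans_le (Cardinal.aleph0_le_mk M)
  refine ⟨e, fun x hx => ?_⟩
  let a : w '' s := ⟨w x, x, hx, rfl⟩
  exact ((h _ (hp a) x hx).1 (hpw a)).symm.trans (he a).symm

section Combination
variable {L₁ L₂ : FirstOrder.Language.{0, 0}}

theorem model_combine_iff {T₁ : L₁.Theory} {T₂ : L₂.Theory} {M : Type*} [L₁.Structure M]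
    [L₂.Structure M] : M ⊨ combine T₁ T₂ ↔ M ⊨ T₁ ∧ M ⊨ T₂ := by
  rw [combine, Theory.model_union_iff, LHom.onTheory_model, LHom.onTheory_model]

theorem sumStructure_reduct {M : Type*} [S : (L₁.sum L₂).Structure M] :
    @Language.sumStructure L₁ L₂ M ((LHom.sumInl : L₁ →ᴸ L₁.sum L₂).reduct M)
      ((LHom.sumInr : L₂ →ᴸ L₁.sum L₂).reduct M) = S := by
  ext k f x <;> rcases f with f | f <;> rfl

variable
  [Encodable (Σ n, L₁.Functions n)] [Encodable (Σ n, L₁.Relations n)]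
  [Encodable (Σ n, L₂.Functions n)] [Encodable (Σ n, L₂.Relations n)]

theorem diagram_id_sum_iff {n : ℕ} {A : List ℕ} {M : Type*} [L₁.Structure M] [L₂.Structure M]
    {w : ℕ → M} : Diagram (LHom.id (L₁.sum L₂)) n A M w ↔
      Diagram (LHom.sumInl : L₁ →ᴸ L₁.sum L₂) n A M w ∧
      Diagram (LHom.sumInr : L₂ →ᴸ L₁.sum L₂) n A M w := by
  constructor
  · intro hw
    exact ⟨⟨hw.equal, fun k f => hw.func k (Sum.inl f), fun k R => hw.rel k (Sum.inl R)⟩,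
      hw.equal, fun k f => hw.func k (Sum.inr f), fun k R => hw.rel k (Sum.inr R)⟩
  · rintro ⟨hw₁, hw₂⟩
    exact ⟨hw₁.equal, fun k f => f.rec (hw₁.func k) (hw₂.func k),
      fun k R => R.rec (hw₁.rel k) (hw₂.rel k)⟩

theorem satisfiable_combine_iff {T₁ : L₁.Theory} {T₂ : L₂.Theory}
    {φ : (L₁.sum L₂).Formula ℕ} (hφ : φ.IsQF) : Satisfiable (combine T₁ T₂) φ ↔
      ∃ A ∈ guesses (code φ), IsTruthSet (code φ) A ∧
        (diagramSpec T₁ (LHom.sumInl : L₁ →ᴸ L₁.sum L₂) (code φ) A ∩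
          diagramSpec T₂ (LHom.sumInr : L₂ →ᴸ L₁.sum L₂) (code φ) A).Nonempty := by
  constructor
  · intro h
    obtain ⟨κ, hκ⟩ := h.spec_nonempty
    obtain ⟨A, hA, hA', hκ, M, S, w, hT, hw, hM⟩ := (mem_spec_iff hφ).1 hκ
    let : L₁.Structure M := (LHom.sumInl : L₁ →ᴸ L₁.sum L₂).reduct M
    let : L₂.Structure M := (LHom.sumInr : L₂ →ᴸ L₁.sum L₂).reduct M
    rw [← sumStructure_reduct (S := S)] at hT hw
    obtain ⟨h₁, h₂⟩ := model_combine_iff.1 hT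
    obtain ⟨hw₁, hw₂⟩ := diagram_id_sum_iff.1 hw
    exact ⟨A, hA, hA', κ, ⟨hκ, M, _, w, h₁, hw₁, hM⟩, hκ, M, _, w, h₂, hw₂, hM⟩
  · rintro ⟨A, -, hA, κ, ⟨-, M, _, w, hM, hw, rfl⟩, -, N, _, w', hN, hw', hNM⟩
    obtain ⟨e, he⟩ := exists_equiv_extending (Cardinal.eq.1 hNM)
      (List.finite_toSet (termNodes (code φ))) (w := w') (w' := w)
      fun s hs t ht => (hw'.equal s hs t ht).trans (hw.equal s hs t ht).symm
    let : L₂.Structure M := e.inducedStructure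
    have hM₂ : M ⊨ T₂ := StrongHomClass.theory_model (e.inducedStructureEquiv (L := L₂))
    let f : N ≃[L₂] M := e.inducedStructureEquiv
    have hw₂ := hw'.map e he (fun _ g _ _ => f.map_fun g) fun _ R _ _ => f.map_rel R
    exact ⟨M, _, _, model_combine_iff.2 ⟨hM, hM₂⟩,
      (diagram_id_sum_iff.2 ⟨hw, hw₂⟩).realize hφ hA⟩

end Combination

/-! ### The gentle combination theorem -/

/-- The set of cardinals described by an output `(b, S)` of the algorithm of a gentle theory:
the positive countable cardinals that belong to `S` if and only if `b` is true. -/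
def gentleSet (p : Bool × List ℕ) : Set Cardinal.{0} :=
  {κ | 0 < κ ∧ κ ≤ ℵ₀ ∧ ((∃ n ∈ p.2, κ = (n : Cardinal)) ↔ p.1 = true)}

theorem natCast_mem_gentleSet {p : Bool × List ℕ} {k : ℕ} :
    (k : Cardinal) ∈ gentleSet p ↔ 0 < k ∧ (k ∈ p.2 ↔ p.1 = true) := by
  simp [gentleSet]

instance decidableNatCastMemGentleSet (p : Bool × List ℕ) (k : ℕ) :
    Decidable ((k : Cardinal) ∈ gentleSet p) :=
  decidable_of_iff' _ natCast_mem_gentleSet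

theorem primrecRel_natCast_mem_gentleSet :
    PrimrecRel fun (k : ℕ) (p : Bool × List ℕ) => (k : Cardinal) ∈ gentleSet p := by
  simp only [natCast_mem_gentleSet]
  exact (Primrec.nat_lt.comp (.const 0) .fst).and
    (primrecPred_iff (primrecRel_mem.comp .fst (Primrec.snd.comp .snd))
      (Primrec.eq.comp (Primrec.fst.comp .snd) (.const true)))

theorem IsGentle.exists_computable_gentleSet {L : FirstOrder.Language.{0, 0}}
    [Encodable (Σ n, L.Functions n)] [Encodable (Σ n, L.Relations n)] {T : L.Theory}
    (h : IsGentle T) : ∃ f : ℕ → Bool × List ℕ, Computable f ∧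
      ∀ φ : L.Formula ℕ, IsCube φ → Spec T φ = gentleSet (f (code φ)) := by
  obtain ⟨f, hf, h⟩ := h
  refine ⟨f, hf, fun φ hφ => ?_⟩
  obtain ⟨hpos, htrue, hfalse⟩ := h φ hφ
  cases hb : (f (code φ)).1 with
  | false => simp [hfalse hb, gentleSet, hb]
  | true =>
    rw [htrue hb]
    ext κ
    simp only [gentleSet, hb, iff_true, Set.mem_ofPred_eq]
    refine ⟨?_, fun hκ => hκ.2.2⟩
    rintro ⟨n, hn, rfl⟩
    exact ⟨by exact_mod_cast hpos n hn, Cardinal.natCast_le_aleph0, n, hn, rfl⟩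

/-- Beyond the sum of its list, a gentle set contains every countable cardinal or none. -/
theorem gentleSet_inter_nonempty_iff {p : Bool × List ℕ} {S : Set Cardinal.{0}}
    (hS : ∀ κ ∈ S, κ ≤ ℵ₀) : (gentleSet p ∩ S).Nonempty ↔
      (∃ k < p.2.sum + 1, (k : Cardinal) ∈ gentleSet p ∧ (k : Cardinal) ∈ S) ∨
        p.1 = false ∧ ∃ κ ∈ S, ((p.2.sum + 1 : ℕ) : Cardinal) ≤ κ := by
  have hlt : ∀ n ∈ p.2, n < p.2.sum + 1 := fun n hn =>
    Nat.lt_succ_of_le (List.single_le_sum (fun _ _ => Nat.zero_le _) n hn)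
  constructor
  · rintro ⟨κ, hκ, hκS⟩
    rcases lt_or_ge κ ((p.2.sum + 1 : ℕ) : Cardinal) with h | h
    · obtain ⟨k, rfl⟩ := Cardinal.lt_aleph0.1 (h.trans Cardinal.natCast_lt_aleph0)
      exact Or.inl ⟨k, by exact_mod_cast h, hκ, hκS⟩
    · refine Or.inr ⟨Bool.eq_false_iff.2 fun hb => ?_, κ, hκS, h⟩
      obtain ⟨n, hn, rfl⟩ := hκ.2.2.2 hb
      exact (hlt n hn).not_ge (by exact_mod_cast h)
  · rintro (⟨k, -, hk, hkS⟩ | ⟨hb, κ, hκ, hle⟩)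
    · exact ⟨k, hk, hkS⟩
    · refine ⟨κ, ⟨?_, hS κ hκ, iff_of_false ?_ (by simp [hb])⟩, hκ⟩
      · exact lt_of_lt_of_le (by exact_mod_cast Nat.succ_pos _) hle
      · rintro ⟨n, hn, rfl⟩
        exact (hlt n hn).not_ge (by exact_mod_cast hle)

/-- Decides whether `gentleSet p` meets a set of countable cardinals, when `g k` says whether the
latter contains `k > 0` and `f j` whether it contains a cardinal `≥ j`. -/
def meetsGentleSet (p : Bool × List ℕ) (g f : ℕ → Bool) : Bool :=
  (List.range (p.2.sum + 1)).any (fun k => decide ((k : Cardinal) ∈ gentleSet p) && g k) ||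
    (!p.1 && f (p.2.sum + 1))

theorem meetsGentleSet_iff {p : Bool × List ℕ} {g f : ℕ → Bool} {S : Set Cardinal.{0}}
    (hS : ∀ κ ∈ S, κ ≤ ℵ₀) (hg : ∀ k : ℕ, 0 < k → (g k = true ↔ (k : Cardinal) ∈ S))
    (hf : ∀ j : ℕ, f j = true ↔ ∃ κ ∈ S, (j : Cardinal) ≤ κ) :
    meetsGentleSet p g f = true ↔ (gentleSet p ∩ S).Nonempty := by
  rw [gentleSet_inter_nonempty_iff hS, meetsGentleSet, Bool.or_eq_true, List.any_eq_true,
    Bool.and_eq_true, hf, Bool.not_eq_true']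
  refine or_congr_left (exists_congr fun k => ?_)
  rw [List.mem_range, Bool.and_eq_true, decide_eq_true_eq]
  exact and_congr_right fun _ => and_congr_right fun hk => hg k (natCast_mem_gentleSet.1 hk).1

theorem primrec_list_sum : Primrec (List.sum : List ℕ → ℕ) :=
  Primrec.list_foldr (h := fun _ (x : ℕ × ℕ) => x.1 + x.2) .id (.const 0)
    (Primrec.nat_add.comp (Primrec.fst.comp .snd) (Primrec.snd.comp .snd))

theorem computable_meetsGentleSet {α : Type*} [Primcodable α] {p : α → Bool × List ℕ}
    {g f : α → ℕ → Bool} (hp : Computable p) (hg : Computable₂ g) (hf : Computable₂ f) :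
    Computable fun a => meetsGentleSet (p a) (g a) (f a) := by
  have hbound : Computable fun a => (p a).2.sum + 1 :=
    (Primrec.succ.comp primrec_list_sum).to_comp.comp (Computable.snd.comp hp)
  have hmem : Computable₂ fun a (k : ℕ) => decide ((k : Cardinal) ∈ gentleSet (p a)) :=
    primrecRel_natCast_mem_gentleSet.decide.to_comp.comp .snd (hp.comp .fst)
  exact Primrec.or.to_comp.comp
    (computable_any (Primrec.list_range.to_comp.comp hbound) (Primrec.and.to_comp.comp hmem hg))
    (Primrec.and.to_comp.comp (Primrec.not.to_comp.comp (Computable.fst.comp hp))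
      (hf.comp .id hbound))

theorem isDecidable_combine {L₁ L₂ : FirstOrder.Language.{0, 0}}
    [Encodable (Σ n, L₁.Functions n)] [Encodable (Σ n, L₁.Relations n)]
    [Encodable (Σ n, L₂.Functions n)] [Encodable (Σ n, L₂.Relations n)]
    {T₁ : L₁.Theory} {T₂ : L₂.Theory} (h₁ : IsGentle T₁) (h₂ : IsDecidable T₂)
    (h₂' : HasComputableFiniteSpectra T₂) : IsDecidable (combine T₁ T₂) := by
  obtain ⟨p, hp, hp_spec⟩ := h₁.exists_computable_gentleSet
  obtain ⟨f, hf, hf_iff⟩ := h₂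
  obtain ⟨g, hg, hg_iff⟩ := h₂'
  have hcube (r : ℕ) {α : Type} [Primcodable α] {j n : α → ℕ} {A : α → List ℕ}
      (hj : Primrec j) (hn : Primrec n) (hA : Primrec A) :
      Computable fun x => cubeCode (summandNumber r) (j x) (n x) (A x) :=
    (primrec_cubeCode (primrec_summandNumber r) hj hn hA).to_comp
  obtain ⟨decision, hdecision, hdecision_iff⟩ := computable_exists_guess (n := fun n : ℕ => n)
    (test := fun n A => meetsGentleSet (p (cubeCode (summandNumber 0) 0 n A))
      (fun k => g (cubeCode (summandNumber 1) 0 n A) k)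
      fun j => f (cubeCode (summandNumber 1) j n A)) .id <|
    computable_meetsGentleSet (hp.comp (hcube 0 (.const 0) .fst .snd))
      (hg.comp (hcube 1 (.const 0) (Primrec.fst.comp .fst) (Primrec.snd.comp .fst)) .snd)
      (hf.comp (hcube 1 .snd (Primrec.fst.comp .fst) (Primrec.snd.comp .fst)))
  refine ⟨decision, hdecision, fun φ hφ => ?_⟩
  rw [hdecision_iff, satisfiable_combine_iff hφ]
  refine exists_congr fun A => and_congr_right fun _ => and_congr_right fun _ => ?_
  have hd₁ : IsTranslation (LHom.sumInl : L₁ →ᴸ L₁.sum L₂) _ := isTranslation_sumInl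
  have hd₂ : IsTranslation (LHom.sumInr : L₂ →ᴸ L₁.sum L₂) _ := isTranslation_sumInr
  obtain ⟨Ψ₁, hΨ₁, hcode₁⟩ := exists_isCube_code_eq_cubeCode hd₁ hφ A 0
  rw [← spec_eq_diagramSpec hd₁ hφ hcode₁, hp_spec Ψ₁ hΨ₁, hcode₁]
  refine meetsGentleSet_iff (fun κ hκ => hκ.1) (fun k hk => ?_) fun j => ?_
  · obtain ⟨Ψ₂, hΨ₂, hcode₂⟩ := exists_isCube_code_eq_cubeCode hd₂ hφ A 0
    rw [← spec_eq_diagramSpec hd₂ hφ hcode₂, ← hcode₂, hg_iff Ψ₂ hΨ₂.isQF k hk]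
  · obtain ⟨Ψ₂, hΨ₂, hcode₂⟩ := exists_isCube_code_eq_cubeCode hd₂ hφ A j
    rw [← satisfiable_iff_exists_mem_diagramSpec hd₂ hφ hcode₂, ← hcode₂, hf_iff Ψ₂ hΨ₂.isQF]

/-! ### Computable finite spectra from spectra of cubes -/

section FiniteSpectra
variable {L : FirstOrder.Language.{0, 0}} [Encodable (Σ n, L.Functions n)]
  [Encodable (Σ n, L.Relations n)] {T : L.Theory}

theorem hasComputableFiniteSpectra_of_diagramSpec {g : ℕ → List ℕ → ℕ → Bool}
    (hg : Computable fun x : (ℕ × ℕ) × List ℕ => g x.1.1 x.2 x.1.2)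
    (hg_iff : ∀ φ : L.Formula ℕ, φ.IsQF → ∀ A, ∀ k : ℕ, 0 < k →
      (g (code φ) A k = true ↔ (k : Cardinal) ∈ diagramSpec T (LHom.id L) (code φ) A)) :
    HasComputableFiniteSpectra T := by
  obtain ⟨f, hf, hf_iff⟩ := computable_exists_guess (n := fun x : ℕ × ℕ => x.1)
    (test := fun x A => g x.1 A x.2) .fst hg
  refine ⟨fun n k => f (n, k), hf, fun φ hφ k hk => ?_⟩
  simp only [hf_iff, mem_spec_iff hφ, hg_iff φ hφ _ k hk]

theorem hasComputableFiniteSpectra_of_isCube {g : ℕ → ℕ → Bool} (hg : Computable₂ g)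
    (hg_iff : ∀ φ : L.Formula ℕ, IsCube φ → ∀ k : ℕ, 0 < k →
      (g (code φ) k = true ↔ (k : Cardinal) ∈ Spec T φ)) :
    HasComputableFiniteSpectra T := by
  refine hasComputableFiniteSpectra_of_diagramSpec (g := fun n A k => g (cubeCode some 0 n A) k)
    (hg.comp (primrec_cubeCode .option_some (.const 0) (Primrec.fst.comp .fst) .snd).to_comp
      (Computable.snd.comp .fst)) fun φ hφ A k hk => ?_
  obtain ⟨Ψ, hΨ, hcode⟩ := exists_isCube_code_eq_cubeCode isTranslation_id hφ A 0
  rw [← hcode, hg_iff Ψ hΨ k hk, spec_eq_diagramSpec isTranslation_id hφ hcode]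

theorem IsGentle.hasComputableFiniteSpectra (h : IsGentle T) : HasComputableFiniteSpectra T := by
  obtain ⟨f, hf, hf_spec⟩ := h.exists_computable_gentleSet
  refine hasComputableFiniteSpectra_of_isCube
    (g := fun c k => decide ((k : Cardinal) ∈ gentleSet (f c)))
    (primrecRel_natCast_mem_gentleSet.decide.to_comp.comp .snd (hf.comp .fst)) fun φ hφ k _ => ?_
  rw [decide_eq_true_eq, hf_spec φ hφ]

theorem HasComputableSpectraAsFiniteSets.hasComputableFiniteSpectra
    (h : HasComputableSpectraAsFiniteSets T) : HasComputableFiniteSpectra T := by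
  obtain ⟨f, hf, hf_spec⟩ := h
  refine hasComputableFiniteSpectra_of_isCube (g := fun c k => decide (some k ∈ f c))
    (primrecRel_mem.decide.to_comp.comp (Computable.option_some.comp .snd) (hf.comp .fst))
    fun φ hφ k _ => ?_
  simp [hf_spec φ hφ, Cardinal.natCast_lt_aleph0.ne]

end FiniteSpectra

/-! ### Agreement of structures on finitely many symbols -/

section PartialIsomorphisms
variable {L : FirstOrder.Language.{0, 0}}

section
variable [Encodable (Σ n, L.Functions n)]

/-- A function symbol, recorded as its kind, its number and the length of the rows of its graph. -/
def funcSymbol {k : ℕ} (f : L.Functions k) : ℕ × ℕ × ℕ :=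
  (1, Encodable.encode (⟨k, f⟩ : Σ n, L.Functions n), k + 1)

/-- The symbols that occur in a term. -/
def termSymbols {α : Type*} : L.Term α → List (ℕ × ℕ × ℕ)
  | .var _ => []
  | .func f ts => funcSymbol f :: (List.ofFn fun i => termSymbols (ts i)).flatten

theorem funcSymbol_mem_termSymbols {α : Type*} {k : ℕ} {f : L.Functions k}
    {ts : Fin k → L.Term α} : funcSymbol f ∈ termSymbols (.func f ts) := by
  simp [termSymbols]

theorem termSymbols_subset_func {α : Type*} {k : ℕ} {f : L.Functions k} {ts : Fin k → L.Term α}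
    (i : Fin k) : termSymbols (ts i) ⊆ termSymbols (.func f ts) := by
  intro s hs
  simp only [termSymbols, List.mem_cons, List.mem_flatten, List.mem_ofFn]
  exact Or.inr ⟨_, ⟨i, rfl⟩, hs⟩

/-- The symbols that occur in the formula with code `n`, and the subterms, whose values are
needed for its diagrams. -/
def diagramSymbols (n : ℕ) : List (ℕ × ℕ × ℕ) :=
  (termNodes n).map (fun m => (0, m, 1)) ++
    ((termNodes n).filter fun m => tag m = 2).map (fun m => (1, lhs m, (args m).length + 1)) ++
    ((formulaNodes n).filter fun m => tag m = 2).map fun m => (2, lhs m, (args m).length)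

theorem mem_diagramSymbols_of_mem_termNodes {n m : ℕ} (h : m ∈ termNodes n) :
    (0, m, 1) ∈ diagramSymbols n := by
  simp [diagramSymbols, h]

theorem funcSymbol_mem_diagramSymbols {n k : ℕ} {f : L.Functions k}
    {ts : Fin k → L.Term (ℕ ⊕ Fin 0)} (h : termCode (Term.func f ts) ∈ termNodes n) :
    funcSymbol f ∈ diagramSymbols n := by
  refine List.mem_append_left _ (List.mem_append_right _
    (List.mem_map.2 ⟨_, List.mem_filter.2 ⟨h, ?_⟩, ?_⟩)) <;>
    simp [termCode, funcSymbol]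

end

/-- A predicate symbol, recorded as its kind, its number and its arity. -/
def relSymbol [Encodable (Σ n, L.Relations n)] {k : ℕ} (R : L.Relations k) : ℕ × ℕ × ℕ :=
  (2, Encodable.encode (⟨k, R⟩ : Σ n, L.Relations n), k)

variable [Encodable (Σ n, L.Functions n)] [Encodable (Σ n, L.Relations n)]

/-- The symbols that occur in a formula. -/
def formulaSymbols {α : Type*} : {m : ℕ} → L.BoundedFormula α m → List (ℕ × ℕ × ℕ)
  | _, .falsum => []
  | _, .equal s t => termSymbols s ++ termSymbols t
  | _, .rel R ts => relSymbol R :: (List.ofFn fun i => termSymbols (ts i)).flatten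
  | _, .imp φ ψ => formulaSymbols φ ++ formulaSymbols ψ
  | _, .all φ => formulaSymbols φ

/-- The bijection `e` is compatible with the interpretations of the symbols listed in `S`. -/
structure IsIsoOn (L : FirstOrder.Language.{0, 0}) [Encodable (Σ n, L.Functions n)]
    [Encodable (Σ n, L.Relations n)] (S : List (ℕ × ℕ × ℕ)) {M N : Type*} [L.Structure M]
    [L.Structure N] (e : M ≃ N) : Prop where
  map_func : ∀ {k : ℕ} (f : L.Functions k), funcSymbol f ∈ S → ∀ y : Fin k → M,
    e (Structure.funMap f y) = Structure.funMap f (e ∘ y)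
  map_rel : ∀ {k : ℕ} (R : L.Relations k), relSymbol R ∈ S → ∀ y : Fin k → M,
    Structure.RelMap R (e ∘ y) ↔ Structure.RelMap R y

variable {S : List (ℕ × ℕ × ℕ)} {M N : Type*} [L.Structure M] [L.Structure N] {e : M ≃ N}

theorem IsIsoOn.realize_term (h : IsIsoOn L S e) {α : Type*} (v : α → M) {t : L.Term α}
    (ht : termSymbols t ⊆ S) : t.realize (e ∘ v) = e (t.realize v) := by
  induction t with
  | var x => rfl
  | func f ts ih =>
    rw [Term.realize, Term.realize, h.map_func f (ht funcSymbol_mem_termSymbols)]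
    exact congrArg (Structure.funMap f)
      (funext fun i => ih i (List.Subset.trans (termSymbols_subset_func i) ht))

theorem IsIsoOn.realize_boundedFormula (h : IsIsoOn L S e) {α : Type*} {m : ℕ}
    {φ : L.BoundedFormula α m} (hφ : formulaSymbols φ ⊆ S) (v : α → M) (xs : Fin m → M) :
    φ.Realize (e ∘ v) (e ∘ xs) ↔ φ.Realize v xs := by
  induction φ with
  | falsum => rfl
  | equal s t =>
    obtain ⟨hs, ht⟩ := List.append_subset.1 hφ
    rw [BoundedFormula.Realize, BoundedFormula.Realize, ← Sum.comp_elim, h.realize_term _ hs,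
      h.realize_term _ ht, e.injective.eq_iff]
  | rel R ts =>
    obtain ⟨hR, hts⟩ := List.cons_subset.1 hφ
    rw [BoundedFormula.Realize, BoundedFormula.Realize, ← Sum.comp_elim, ← h.map_rel R hR]
    have hargs (i) : termSymbols (ts i) ⊆ S := fun s hs =>
      hts (List.mem_flatten.2 ⟨_, List.mem_ofFn.2 ⟨i, rfl⟩, hs⟩)
    exact iff_of_eq (congrArg (Structure.RelMap R) (funext fun i => h.realize_term _ (hargs i)))
  | imp φ ψ ih₁ ih₂ =>
    obtain ⟨h₁, h₂⟩ := List.append_subset.1 hφ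
    rw [BoundedFormula.Realize, ih₁ h₁, ih₂ h₂, BoundedFormula.Realize]
  | all φ ih =>
    rw [BoundedFormula.Realize, BoundedFormula.Realize, ← e.forall_congr_right]
    simp only [← Fin.comp_snoc, ih hφ]

theorem IsIsoOn.realize_sentence (h : IsIsoOn L S e) {ψ : L.Sentence}
    (hψ : formulaSymbols ψ ⊆ S) : N ⊨ ψ ↔ M ⊨ ψ := by
  have := h.realize_boundedFormula hψ default default
  rwa [Unique.eq_default (e ∘ default), Unique.eq_default (e ∘ default)] at this

theorem relSymbol_mem_diagramSymbols {n k : ℕ} {R : L.Relations k}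
    {ts : Fin k → L.Term (ℕ ⊕ Fin 0)}
    (h : code (BoundedFormula.rel R ts : L.Formula ℕ) ∈ formulaNodes n) :
    relSymbol R ∈ diagramSymbols n := by
  refine List.mem_append_right _ (List.mem_map.2 ⟨_, List.mem_filter.2 ⟨h, ?_⟩, ?_⟩) <;>
    simp [code, relSymbol]

theorem IsIsoOn.diagram {n : ℕ} {A : List ℕ} {w : ℕ → M} {w' : ℕ → N} (h : IsIsoOn L S e)
    (hS : diagramSymbols n ⊆ S) (hw : ∀ i, (0, i, 1) ∈ S → w' i = e (w i))
    (hM : Diagram (LHom.id L) n A M w) : Diagram (LHom.id L) n A N w' :=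
  hM.map e (fun _ hs => hw _ (hS (mem_diagramSymbols_of_mem_termNodes hs)))
    (fun _ f _ hm => h.map_func f (hS (funcSymbol_mem_diagramSymbols hm)))
    fun _ R _ hm => h.map_rel R (hS (relSymbol_mem_diagramSymbols hm))

end PartialIsomorphisms

/-! ### Finite structures given by tables -/

/-- A table `(k, l)` describes a structure with elements `0, …, k` and a sequence of elements of it
by the list `l` of facts: `(0, i, [v])` says that the term number `i` of the sequence is `v`,
`(1, c, v :: y)` that the function symbol number `c` has the value `v` at `y`, and `(2, c, y)` that
the predicate symbol number `c` holds of `y`. -/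
abbrev Table := ℕ × List (ℕ × ℕ × List ℕ)

/-- The domain `{0, …, k}` of the structure described by the table `(k, l)`. -/
def TableModel (x : Table) : Type := Fin (x.1 + 1)

/-- The natural number that an element of the structure described by a table is. -/
def TableModel.toNat {x : Table} (a : TableModel x) : ℕ := Fin.val a

/-- The natural number `v` as an element of the structure described by a table (reduced modulo the
number of elements). -/
def TableModel.ofNat (x : Table) (v : ℕ) : TableModel x := Fin.ofNat (x.1 + 1) v

theorem TableModel.toNat_injective {x : Table} :
    Function.Injective (TableModel.toNat : TableModel x → ℕ) :=
  Fin.val_injective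

theorem TableModel.toNat_lt {x : Table} (a : TableModel x) : a.toNat < x.1 + 1 :=
  Fin.isLt a

theorem TableModel.ofNat_toNat {x : Table} (a : TableModel x) :
    TableModel.ofNat x a.toNat = a :=
  toNat_injective (Nat.mod_eq_of_lt a.toNat_lt)

theorem mk_tableModel (x : Table) : #(TableModel x) = ((x.1 + 1 : ℕ) : Cardinal) :=
  Cardinal.mk_fin _

/-- The first value that the table asserts for the symbol of kind `i` and number `c` at `y`
(and `0` if there is none). -/
def Table.value (x : Table) (i c : ℕ) (y : List ℕ) : TableModel x :=
  .ofNat x ((List.range (x.1 + 1)).findIdx fun v => (i, c, v :: y) ∈ x.2)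

theorem Table.value_eq {x : Table} {i c : ℕ} {y : List ℕ} {a : TableModel x}
    (h : ∀ b : TableModel x, (i, c, b.toNat :: y) ∈ x.2 ↔ b = a) : x.value i c y = a := by
  have hidx : (List.range (x.1 + 1)).findIdx (fun v => (i, c, v :: y) ∈ x.2) = a.toNat := by
    rw [List.findIdx_eq (by simpa using a.toNat_lt)]
    simp only [List.getElem_range, decide_eq_true_eq, decide_eq_false_iff_not]
    refine ⟨(h a).2 rfl, fun v hv hmem => ?_⟩
    have hv' : (TableModel.ofNat x v).toNat = v :=
      Nat.mod_eq_of_lt (hv.trans a.toNat_lt)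
    rw [← hv', h] at hmem
    rw [← hv', hmem] at hv
    exact hv.false
  rw [Table.value, hidx, TableModel.ofNat_toNat]

/-- The structure described by a table: a predicate symbol holds at the rows listed in the table,
and a function symbol takes the value that the table asserts. -/
instance tableModelStructure {L : FirstOrder.Language.{0, 0}} [Encodable (Σ n, L.Functions n)]
    [Encodable (Σ n, L.Relations n)] (x : Table) : L.Structure (TableModel x) where
  funMap {k} f y := x.value 1 (Encodable.encode (⟨k, f⟩ : Σ n, L.Functions n))
    (List.ofFn fun i => (y i).toNat)
  RelMap {k} R y := (2, Encodable.encode (⟨k, R⟩ : Σ n, L.Relations n),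
    List.ofFn fun i => (y i).toNat) ∈ x.2

instance (x : Table) : Nonempty (TableModel x) := ⟨.ofNat x 0⟩

/-- The sequence of elements described by a table. -/
def Table.sequence (x : Table) (i : ℕ) : TableModel x := x.value 0 i []

/-- All lists of length `r` with entries in `{0, …, k}`. -/
def tuples (k r : ℕ) : List (List ℕ) :=
  (fun l => (List.range (k + 1)).flatMap fun v => l.map (List.cons v))^[r] [ [] ]

theorem mem_tuples {k r : ℕ} {y : List ℕ} :
    y ∈ tuples k r ↔ y.length = r ∧ ∀ v ∈ y, v < k + 1 := by
  induction r generalizing y with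
  | zero => cases y <;> simp [tuples]
  | succ r ih =>
    rw [tuples, Function.iterate_succ_apply', ← tuples]
    cases y <;> simp [ih, and_left_comm]

/-- All facts with entries in `{0, …, k}` about the symbols in `S`, each symbol being recorded as
its kind, its number and the length of its facts. -/
def facts (k : ℕ) (S : List (ℕ × ℕ × ℕ)) : List (ℕ × ℕ × List ℕ) :=
  S.flatMap fun s => (tuples k s.2.2).map fun y => (s.1, s.2.1, y)

theorem mem_facts {k i c : ℕ} {S : List (ℕ × ℕ × ℕ)} {y : List ℕ} :
    (i, c, y) ∈ facts k S ↔ (i, c, y.length) ∈ S ∧ ∀ v ∈ y, v < k + 1 := by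
  simp only [facts, List.mem_flatMap, List.mem_map, mem_tuples, Prod.mk.injEq, Prod.exists]
  constructor
  · rintro ⟨_, _, _, hS, _, ⟨rfl, hy⟩, rfl, rfl, rfl⟩
    exact ⟨hS, hy⟩
  · rintro ⟨hS, hy⟩
    exact ⟨_, _, _, hS, y, ⟨rfl, hy⟩, rfl, rfl, rfl⟩

/-- All tables for structures with `k + 1` elements that mention only the symbols in `S`. -/
def tables (k : ℕ) (S : List (ℕ × ℕ × ℕ)) : List Table :=
  (facts k S).sublists'.map (Prod.mk k)

section TrueFacts
variable {L : FirstOrder.Language.{0, 0}} [Encodable (Σ n, L.Functions n)]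
  [Encodable (Σ n, L.Relations n)] {M : Type*} [L.Structure M]

/-- The facts that hold of the structure `M` and of the sequence `w`, when the elements of `M` are
numbered by `e`. -/
inductive IsFact (L : FirstOrder.Language.{0, 0}) [Encodable (Σ n, L.Functions n)]
    [Encodable (Σ n, L.Relations n)] {M : Type*} [L.Structure M] (e : M → ℕ) (w : ℕ → M) :
    ℕ × ℕ × List ℕ → Prop
  | sequence (i : ℕ) : IsFact L e w (0, i, [e (w i)])
  | func {k : ℕ} (f : L.Functions k) (y : Fin k → M) :
      IsFact L e w (1, Encodable.encode (⟨k, f⟩ : Σ n, L.Functions n),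
        e (Structure.funMap f y) :: List.ofFn (e ∘ y))
  | rel {k : ℕ} (R : L.Relations k) (y : Fin k → M) (h : Structure.RelMap R y) :
      IsFact L e w (2, Encodable.encode (⟨k, R⟩ : Σ n, L.Relations n), List.ofFn (e ∘ y))

variable {e : M → ℕ} {w : ℕ → M}

theorem isFact_sequence_iff {i v : ℕ} : IsFact L e w (0, i, [v]) ↔ v = e (w i) :=
  ⟨fun h => by cases h; rfl, fun h => h ▸ .sequence i⟩

theorem isFact_func_iff (he : Function.Injective e) {k : ℕ} {f : L.Functions k} {y : Fin k → M}
    {v : ℕ} : IsFact L e w (1, Encodable.encode (⟨k, f⟩ : Σ n, L.Functions n),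
      v :: List.ofFn (e ∘ y)) ↔ v = e (Structure.funMap f y) := by
  refine ⟨fun h => ?_, fun h => h ▸ .func f y⟩
  generalize hc : Encodable.encode (⟨k, f⟩ : Σ n, L.Functions n) = c at h
  generalize hl : List.ofFn (e ∘ y) = l at h
  cases h with
  | func g z =>
    cases Encodable.encode_injective hc
    rw [he.comp_left (List.ofFn_injective hl)]

theorem isFact_rel_iff (he : Function.Injective e) {k : ℕ} {R : L.Relations k} {y : Fin k → M} :
    IsFact L e w (2, Encodable.encode (⟨k, R⟩ : Σ n, L.Relations n), List.ofFn (e ∘ y)) ↔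
      Structure.RelMap R y := by
  refine ⟨fun h => ?_, .rel R y⟩
  generalize hc : Encodable.encode (⟨k, R⟩ : Σ n, L.Relations n) = c at h
  generalize hl : List.ofFn (e ∘ y) = l at h
  cases h with
  | rel R z h =>
    cases Encodable.encode_injective hc
    rwa [he.comp_left (List.ofFn_injective hl)]

theorem exists_table (S : List (ℕ × ℕ × ℕ)) {k : ℕ} (hM : Nonempty (M ≃ Fin (k + 1)))
    (w : ℕ → M) : ∃ x ∈ tables k S, ∃ e : M ≃ TableModel x, IsIsoOn L S e ∧
      ∀ i, (0, i, 1) ∈ S → x.sequence i = e (w i) := by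
  classical
  obtain ⟨e⟩ := hM
  let x : Table := (k, (facts k S).filter (IsFact L (fun a => (e a).val) w))
  let e' : M ≃ TableModel x := e
  have he : Function.Injective fun a => (e' a).toNat :=
    TableModel.toNat_injective.comp e'.injective
  have hfact {i c : ℕ} {y : List ℕ} : (i, c, y) ∈ x.2 ↔ ((i, c, y.length) ∈ S ∧
      ∀ v ∈ y, v < k + 1) ∧ IsFact L (fun a => (e' a).toNat) w (i, c, y) := by
    rw [← mem_facts, List.mem_filter, decide_eq_true_eq]
    rfl
  have hle (a : TableModel x) : a.toNat ≤ k := Nat.le_of_lt_succ a.toNat_lt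
  refine ⟨x, List.mem_map.2 ⟨_, List.mem_sublists'.2 List.filter_sublist, rfl⟩, e', ⟨?_, ?_⟩, ?_⟩
  · intro n f hf y
    refine (Table.value_eq fun b => hfact.trans ?_).symm
    have hmem : (1, Encodable.encode (⟨n, f⟩ : Σ n, L.Functions n),
        (b.toNat :: List.ofFn fun i => (e' (y i)).toNat).length) ∈ S := by
      simpa [funcSymbol] using hf
    have hbound : ∀ v ∈ b.toNat :: List.ofFn fun i => (e' (y i)).toNat, v < k + 1 := by
      simp [List.mem_ofFn, hle]
    exact (and_iff_right ⟨hmem, hbound⟩).trans <|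
      (isFact_func_iff he).trans TableModel.toNat_injective.eq_iff
  · intro n R hR y
    refine hfact.trans ((and_iff_right ⟨?_, ?_⟩).trans (isFact_rel_iff he))
    · simpa [relSymbol] using hR
    · simp [List.mem_ofFn, hle]
  · intro i hi
    refine Table.value_eq fun b => hfact.trans ((and_iff_right ⟨hi, ?_⟩).trans ?_)
    · exact isFact_sequence_iff.trans TableModel.toNat_injective.eq_iff
    · simpa [Nat.lt_succ_iff] using hle b

end TrueFacts

theorem primrec_tableValue {β : Type*} [Primcodable β] {x : β → Table} {i c : β → ℕ}
    {y : β → List ℕ} (hx : Primrec x)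
    (hi : Primrec i) (hc : Primrec c) (hy : Primrec y) :
    Primrec fun b => ((x b).value (i b) (c b) (y b)).toNat := by
  have hmem : PrimrecRel fun b v => (i b, c b, v :: y b) ∈ (x b).2 :=
    primrecRel_mem.comp
      ((hi.comp .fst).pair ((hc.comp .fst).pair (Primrec.list_cons.comp .snd (hy.comp .fst))))
      (Primrec.snd.comp (hx.comp .fst))
  have hsize : Primrec fun b => (x b).1 + 1 := Primrec.succ.comp (Primrec.fst.comp hx)
  exact Primrec.nat_mod.comp
    (Primrec.list_findIdx (Primrec.list_range.comp hsize) hmem.decide) hsize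

theorem primrec_tuples : Primrec₂ tuples := by
  refine Primrec.nat_iterate .snd (.const [ [] ]) ?_
  refine Primrec.list_flatMap
    (Primrec.list_range.comp (Primrec.succ.comp (Primrec.fst.comp .fst))) ?_
  exact Primrec.list_map (Primrec.snd.comp .fst)
    (Primrec.list_cons.comp (Primrec.snd.comp .fst) .snd)

theorem primrec_facts : Primrec₂ facts := by
  refine Primrec.list_flatMap .snd ?_
  have hs : Primrec fun b : (ℕ × List (ℕ × ℕ × ℕ)) × ℕ × ℕ × ℕ => b.2 := .snd
  refine Primrec.list_map (primrec_tuples.comp (Primrec.fst.comp .fst)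
    (Primrec.snd.comp (Primrec.snd.comp hs))) ?_
  exact (Primrec.fst.comp (hs.comp .fst)).pair
    ((Primrec.fst.comp (Primrec.snd.comp (hs.comp .fst))).pair .snd)

theorem primrec_tables : Primrec₂ tables :=
  Primrec.list_map (primrec_sublists'.comp primrec_facts)
    ((Primrec.fst.comp .fst).pair .snd)

theorem primrec_diagramSymbols : Primrec diagramSymbols := by
  have hlength : Primrec fun x : ℕ × ℕ => (args x.2).length :=
    Primrec.list_length.comp (primrec_args.comp .snd)
  refine Primrec.list_append.comp (Primrec.list_append.comp ?_ ?_) ?_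
  · exact Primrec.list_map primrec_termNodes ((Primrec.const 0).pair (.pair .snd (.const 1)))
  · exact Primrec.list_map (primrec_tag_filter.comp primrec_termNodes)
      ((Primrec.const 1).pair ((primrec_lhs.comp .snd).pair (Primrec.succ.comp hlength)))
  · exact Primrec.list_map (primrec_tag_filter.comp primrec_formulaNodes)
      ((Primrec.const 2).pair ((primrec_lhs.comp .snd).pair hlength))

section Evaluation
variable {L : FirstOrder.Language.{0, 0}} [Encodable (Σ n, L.Functions n)]
  [Encodable (Σ n, L.Relations n)]

theorem primrec_realize_term {β : Type*} [Primcodable β] {x : β → Table} (hx : Primrec x)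
    {α : Type*} {v : ∀ b, α → TableModel (x b)} (hv : ∀ a, Primrec fun b => (v b a).toNat)
    (t : L.Term α) : Primrec fun b => (t.realize (v b)).toNat := by
  induction t with
  | var a => exact hv a
  | func f ts ih => exact primrec_tableValue hx (.const 1) (.const _) (Primrec.list_ofFn ih)

theorem primrecPred_realize {α : Type*} {m : ℕ} (φ : L.BoundedFormula α m) {β : Type*}
    [Primcodable β] {x : β → Table} (hx : Primrec x) {v : ∀ b, α → TableModel (x b)}
    (hv : ∀ a, Primrec fun b => (v b a).toNat) {xs : ∀ b, Fin m → TableModel (x b)}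
    (hxs : ∀ i, Primrec fun b => (xs b i).toNat) :
    PrimrecPred fun b => φ.Realize (v b) (xs b) := by
  induction φ generalizing β with
  | falsum => exact ⟨fun _ => .isFalse not_false, .const false⟩
  | equal s t =>
    have hval : ∀ a, Primrec fun b => (Sum.elim (v b) (xs b) a).toNat := Sum.rec hv hxs
    refine (Primrec.eq.comp (primrec_realize_term hx hval s)
      (primrec_realize_term hx hval t)).of_eq fun b => ?_
    exact TableModel.toNat_injective.eq_iff
  | rel R ts =>
    have hval : ∀ a, Primrec fun b => (Sum.elim (v b) (xs b) a).toNat := Sum.rec hv hxs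
    exact primrecRel_mem.comp (.pair (.const 2) (.pair (.const _)
      (Primrec.list_ofFn fun i => primrec_realize_term hx hval (ts i)))) (Primrec.snd.comp hx)
  | imp φ ψ ih₁ ih₂ => exact primrecPred_imp (ih₁ hx hv hxs) (ih₂ hx hv hxs)
  | @all m φ ih =>
    have hsnoc (i : Fin (m + 1)) : Primrec fun c : ℕ × β =>
        (Fin.snoc (α := fun _ => TableModel (x c.2)) (xs c.2) (.ofNat (x c.2) c.1) i).toNat := by
      refine Fin.lastCases ?_ (fun j => ?_) i
      · simp only [Fin.snoc_last]
        exact Primrec.nat_mod.comp .fst (Primrec.succ.comp (Primrec.fst.comp (hx.comp .snd)))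
      · simpa only [Fin.snoc_castSucc] using (hxs j).comp .snd
    have hφ : PrimrecRel fun (a : ℕ) (b : β) =>
        φ.Realize (v b) (Fin.snoc (xs b) (.ofNat (x b) a)) :=
      ih (hx.comp .snd) (fun a => (hv a).comp .snd) hsnoc
    refine (primrecPred_forall_mem
      (Primrec.list_range.comp (Primrec.succ.comp (Primrec.fst.comp hx))) hφ).of_eq fun b => ?_
    refine ⟨fun h a => ?_, fun h a _ => h _⟩
    rw [← a.ofNat_toNat]
    exact h _ (List.mem_range.2 a.toNat_lt)

end Evaluation

/-- The diagram of the guess `A` for the formula with code `n` holds in the structure described by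
the table `x`, for the sequence that it describes. -/
def TableDiagram (n : ℕ) (A : List ℕ) (x : Table) : Prop :=
  (∀ s ∈ termNodes n, ∀ t ∈ termNodes n, x.sequence s = x.sequence t ↔ equalCode s t ∈ A) ∧
  (∀ m ∈ termNodes n, tag m = 2 →
    x.sequence m = x.value 1 (lhs m) ((args m).map fun a => (x.sequence a).toNat)) ∧
  ∀ m ∈ formulaNodes n, tag m = 2 →
    ((2, lhs m, (args m).map fun a => (x.sequence a).toNat) ∈ x.2 ↔ m ∈ A)

theorem primrec_tableSequence {β : Type*} [Primcodable β] {x : β → Table} {i : β → ℕ}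
    (hx : Primrec x) (hi : Primrec i) : Primrec fun b => ((x b).sequence (i b)).toNat :=
  primrec_tableValue hx (.const 0) hi (.const [])

theorem primrec_map_tableSequence {β : Type*} [Primcodable β] {x : β → Table} {l : β → List ℕ}
    (hx : Primrec x) (hl : Primrec l) :
    Primrec fun b => (l b).map fun a => ((x b).sequence a).toNat :=
  Primrec.list_map hl (primrec_tableSequence (hx.comp .fst) .snd)

theorem primrecPred_tableDiagram {β : Type*} [Primcodable β] {n : β → ℕ} {A : β → List ℕ}
    {x : β → Table} (hn : Primrec n) (hA : Primrec A) (hx : Primrec x) :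
    PrimrecPred fun b => TableDiagram (n b) (A b) (x b) := by
  have hterms := primrec_termNodes.comp hn
  have hx' : Primrec fun p : ℕ × β => x p.2 := hx.comp .snd
  have htag : PrimrecPred fun p : ℕ × β => tag p.1 = 2 :=
    Primrec.eq.comp (primrec_tag.comp .fst) (.const 2)
  have hlhs : Primrec fun p : ℕ × β => lhs p.1 := primrec_lhs.comp .fst
  have hargs : Primrec fun p : ℕ × β => (args p.1).map fun a => ((x p.2).sequence a).toNat :=
    primrec_map_tableSequence hx' (primrec_args.comp .fst)
  refine .and ?_ (.and ?_ ?_)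
  · refine primrecPred_forall_mem hterms (primrecPred_forall_mem (hterms.comp .snd) ?_)
    have hs : Primrec fun p : ℕ × ℕ × β => p.2.1 := Primrec.fst.comp .snd
    have hx'' : Primrec fun p : ℕ × ℕ × β => x p.2.2 := hx'.comp .snd
    refine primrecPred_iff ?_ (primrecRel_mem.comp (primrec_equalCode.comp hs .fst)
      (hA.comp (Primrec.snd.comp .snd)))
    exact (Primrec.eq.comp (primrec_tableSequence hx'' hs)
      (primrec_tableSequence hx'' .fst)).of_eq fun _ => TableModel.toNat_injective.eq_iff
  · refine primrecPred_forall_mem hterms (primrecPred_imp htag ?_)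
    exact (Primrec.eq.comp (primrec_tableSequence hx' .fst)
      (primrec_tableValue hx' (.const 1) hlhs hargs)).of_eq fun _ =>
        TableModel.toNat_injective.eq_iff
  · refine primrecPred_forall_mem (primrec_formulaNodes.comp hn) (primrecPred_imp htag ?_)
    exact primrecPred_iff (primrecRel_mem.comp (.pair (.const 2) (.pair hlhs hargs))
      (Primrec.snd.comp hx')) (primrecRel_mem.comp .fst (hA.comp .snd))

section FiniteAxiomatizability
variable {L : FirstOrder.Language.{0, 0}}

theorem IsFinitelyAxiomatizable.exists_sentence {T : L.Theory} (h : IsFinitelyAxiomatizable T) :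
    ∃ ψ : L.Sentence, ∀ (M : Type) [L.Structure M] [Nonempty M], M ⊨ T ↔ M ⊨ ψ := by
  obtain ⟨Γ, hΓ, h⟩ := h
  have := hΓ.to_subtype
  refine ⟨Formula.iInf fun γ : Γ => γ.1, fun M _ _ => (h M).trans ?_⟩
  rw [Theory.model_iff, Sentence.Realize, Formula.realize_iInf, Subtype.forall]
  rfl

variable [Encodable (Σ n, L.Functions n)] [Encodable (Σ n, L.Relations n)]

theorem tableModel_funMap_sequence (x : Table) {k : ℕ} (f : L.Functions k)
    (ts : Fin k → L.Term (ℕ ⊕ Fin 0)) :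
    Structure.funMap f (fun i => x.sequence (termCode (ts i))) =
      x.value 1 (lhs (termCode (.func f ts)))
        ((args (termCode (.func f ts))).map fun a => (x.sequence a).toNat) := by
  rw [termCode, lhs_pair_pair, args_pair_pair, List.map_ofFn]
  rfl

theorem tableModel_relMap_sequence_iff (x : Table) {k : ℕ} (R : L.Relations k)
    (ts : Fin k → L.Term (ℕ ⊕ Fin 0)) :
    Structure.RelMap R (fun i => x.sequence (termCode (ts i))) ↔
      (2, lhs (code (.rel R ts)), (args (code (.rel R ts))).map fun a => (x.sequence a).toNat)
        ∈ x.2 := by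
  rw [code, lhs_pair_pair, args_pair_pair, List.map_ofFn]
  rfl

theorem tableDiagram_code_iff {φ : L.Formula ℕ} (hφ : φ.IsQF) {A : List ℕ} {x : Table} :
    TableDiagram (code φ) A x ↔ Diagram (LHom.id L) (code φ) A (TableModel x) x.sequence := by
  constructor
  · rintro ⟨hequal, hfunc, hrel⟩
    refine ⟨hequal, fun k f ts hm => ?_, fun k R ts hm => ?_⟩
    · exact (hfunc _ hm (by simp [termCode])).trans (tableModel_funMap_sequence x f ts).symm
    · exact (tableModel_relMap_sequence_iff x R ts).trans (hrel _ hm (by simp [code]))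
  · intro h
    refine ⟨h.equal, fun m hm htag => ?_, fun m hm htag => ?_⟩
    · obtain ⟨k, f, ts, rfl⟩ := exists_func_of_mem_termNodes hφ hm htag
      exact (h.func k f ts hm).trans (tableModel_funMap_sequence x f ts)
    · obtain ⟨k, R, ts, rfl⟩ := exists_rel_of_mem_formulaNodes hφ hm htag
      exact (tableModel_relMap_sequence_iff x R ts).symm.trans (h.rel k R ts hm)

theorem natCast_succ_mem_diagramSpec_iff {T : L.Theory} {ψ : L.Sentence}
    (hψ : ∀ (M : Type) [L.Structure M] [Nonempty M], M ⊨ T ↔ M ⊨ ψ) {φ : L.Formula ℕ}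
    (hφ : φ.IsQF) {A : List ℕ} {k : ℕ} :
    ((k + 1 : ℕ) : Cardinal) ∈ diagramSpec T (LHom.id L) (code φ) A ↔
      ∃ x ∈ tables k (formulaSymbols ψ ++ diagramSymbols (code φ)),
        TableModel x ⊨ ψ ∧ TableDiagram (code φ) A x := by
  constructor
  · rintro ⟨-, M, _, w, hT, hw, hM⟩
    have : Nonempty M := ⟨w 0⟩
    have hM' : Nonempty (M ≃ Fin (k + 1)) := Cardinal.eq.1 (hM.trans (Cardinal.mk_fin _).symm)
    obtain ⟨x, hx, e, he, hseq⟩ :=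
      exists_table (L := L) (formulaSymbols ψ ++ diagramSymbols (code φ)) hM' w
    refine ⟨x, hx, (he.realize_sentence (List.subset_append_left _ _)).2 ((hψ M).1 hT), ?_⟩
    exact (tableDiagram_code_iff hφ).2 (he.diagram (List.subset_append_right _ _) hseq hw)
  · rintro ⟨x, hx, hxψ, hxA⟩
    have hcard : x.1 = k := by
      obtain ⟨l, -, rfl⟩ := List.mem_map.1 hx
      rfl
    refine ⟨Cardinal.natCast_le_aleph0, TableModel x, _, x.sequence, (hψ _).2 hxψ,
      (tableDiagram_code_iff hφ).1 hxA, ?_⟩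
    rw [mk_tableModel, hcard]

theorem IsFinitelyAxiomatizable.hasComputableFiniteSpectra {T : L.Theory}
    (h : IsFinitelyAxiomatizable T) : HasComputableFiniteSpectra T := by
  classical
  obtain ⟨ψ, hψ⟩ := h.exists_sentence
  have hsearch : PrimrecPred fun p : (ℕ × ℕ) × List ℕ =>
      ∃ x ∈ tables (p.1.2 - 1) (formulaSymbols ψ ++ diagramSymbols p.1.1),
        TableModel x ⊨ ψ ∧ TableDiagram p.1.1 p.2 x := by
    have hn : Primrec fun p : (ℕ × ℕ) × List ℕ => p.1.1 := Primrec.fst.comp .fst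
    refine PrimrecRel.comp (PrimrecRel.exists_mem_list (R := fun x (p : (ℕ × ℕ) × List ℕ) =>
      TableModel x ⊨ ψ ∧ TableDiagram p.1.1 p.2 x) ?_)
      (primrec_tables.comp (Primrec.pred.comp (Primrec.snd.comp .fst))
        (Primrec.list_append.comp (.const _) (primrec_diagramSymbols.comp hn))) .id
    exact (primrecPred_realize ψ .fst (fun a => a.elim) fun i => i.elim0).and
      (primrecPred_tableDiagram (hn.comp .snd) (Primrec.snd.comp .snd) .fst)
  refine hasComputableFiniteSpectra_of_diagramSpec (g := fun n A k => decide
    (∃ x ∈ tables (k - 1) (formulaSymbols ψ ++ diagramSymbols n),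
      TableModel x ⊨ ψ ∧ TableDiagram n A x)) hsearch.decide.to_comp fun φ hφ A k hk => ?_
  rw [decide_eq_true_eq, ← natCast_succ_mem_diagramSpec_iff hψ hφ, Nat.sub_add_cancel hk]

end FiniteAxiomatizability

end TheoryCombination

theorem mainTheorem10
    {L₁ L₂ : FirstOrder.Language.{0, 0}}
    [Encodable (Σ n, L₁.Functions n)] [Encodable (Σ n, L₁.Relations n)]
    [Encodable (Σ n, L₂.Functions n)] [Encodable (Σ n, L₂.Relations n)]
    (T₁ : L₁.Theory) (T₂ : L₂.Theory) :
    (TheoryCombination.IsGentle T₁ →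
      TheoryCombination.IsDecidable T₂ →
      TheoryCombination.HasComputableFiniteSpectra T₂ →
      TheoryCombination.IsDecidable (TheoryCombination.combine T₁ T₂)) ∧
    (TheoryCombination.IsGentle T₂ ∨
      TheoryCombination.IsFinitelyAxiomatizable T₂ ∨
      TheoryCombination.HasComputableSpectraAsFiniteSets T₂ →
      TheoryCombination.HasComputableFiniteSpectra T₂) := by
  refine ⟨TheoryCombination.isDecidable_combine, ?_⟩
  rintro (h | h | h)
  exacts [h.hasComputableFiniteSpectra, h.hasComputableFiniteSpectra,
    h.hasComputableFiniteSpectra]
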